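/- Let $n\ge 1$ and $1<q<\infty$, with $\frac1q+\frac1{q'}=1$. Let $d\gamma(x)=(2\pi)^{-n/2}e^{-|x|^2/2}\,dx$ be the standard Gaussian measure on $\mathbb R^n$, let $B(x,r)=\{y:|x-y|<r\}$, let $m(x)=\min\{1,1/|x|\}$ (with $m(0)=1$), and let $D=\{(y,t)\in\mathbb R^n\times(0,\infty): t<m(y)\}$. The Gaussian tent space $T^{1,q}(\gamma)$ is the completion of the space $C_c(D)$ of continuous complex functions with compact support in $D$ with respect to the norm $$\|f\|_{T^{1,q}(\gamma)}=\int_{\mathbb R^n}\Big(\iint_D \frac{\mathbf 1_{B(y,t)}(x)}{\gamma(B(y,t))}\,|f(y,t)|^q\,d\gamma(y)\frac{dt}{t}\Big)^{1/q}d\gamma(x).$$ For $\alpha>0$, a $T^{1,q}(\gamma)$ $\alpha$-atom is a measurable function $a:D\to\mathbb C$ for which there is a ball $B=B(c,r)$ with $0\le r\le \alpha\, m(c)$ such that $a$ vanishes outside the tent $T_1(B)=\{(y,t)\in\mathbb R^n\times(0,\infty): d(y,\mathbb R^n\setminus B)\ge t\}$ and $$\Big(\iint_D |a(y,t)|^q\,d\gamma(y)\frac{dt}{t}\Big)^{1/q}\le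 \gamma(B)^{-1/q'}.$$ Theorem (Atomic decomposition). For every $\alpha>1$ there is a constant $C$, depending only on $n$, $q$ and $\alpha$, such that for every $f\in T^{1,q}(\gamma)$ there exist a sequence $(\lambda_k)_{k\ge1}\in\ell_1$ of complex numbers and a sequence $(a_k)_{k\ge1}$ of $T^{1,q}(\gamma)$ $\alpha$-atoms, each of which belongs to $T^{1,q}(\gamma)$, such that $$f=\sum_{k\ge1}\lambda_k a_k \quad\text{in } T^{1,q}(\gamma),\qquad \sum_{k\ge1}|\lambda_k|\le C\,\|f\|_{T^{1,q}(\gamma)}.$$ Here a measurable function $u$ on $D$ is said to belong to $T^{1,q}(\gamma)$, and is identified with $F\in T^{1,q}(\gamma)$, if some sequence $(g_j)$ in $C_c(D)$ converges to $F$ in the completion and satisfies $\|u-g_j\|_{T^{1,q}(\gamma)}\to0$, where for measurable functions $\|\cdot\|_{T^{1,q}(\gamma)}$ is given by the formula above. -/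

import Mathlib

open MeasureTheory Filter Topology Set
open scoped ENNReal CompactlySupported

noncomputable section

namespace GaussianTent

/-- The standard Gaussian measure `(2π)^(-n/2) exp(-|x|²/2) dx` on `ℝⁿ`. -/
def gaussian (n : ℕ) : Measure (EuclideanSpace ℝ (Fin n)) :=
  volume.withDensity fun x =>
    ENNReal.ofReal ((2 * Real.pi) ^ (-(n : ℝ) / 2) * Real.exp (-(‖x‖ ^ 2) / 2))

/-- `m(x) = min {1, 1/|x|}`, written as `1 / max {1, |x|}` so that `m(0) = 1`. -/
def adm {n : ℕ} (x : EuclideanSpace ℝ (Fin n)) : ℝ := (max 1 ‖x‖)⁻¹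

theorem adm_zero {n : ℕ} : adm (0 : EuclideanSpace ℝ (Fin n)) = 1 := by simp [adm]

theorem adm_eq_min {n : ℕ} {x : EuclideanSpace ℝ (Fin n)} (hx : x ≠ 0) :
    adm x = min 1 (1 / ‖x‖) := by
  have h : 0 < ‖x‖ := norm_pos_iff.2 hx
  unfold adm
  rcases le_total 1 ‖x‖ with h1 | h1
  · rw [max_eq_right h1, min_eq_right, one_div]
    rw [one_div]; exact inv_le_one_of_one_le₀ h1
  · rw [max_eq_left h1, min_eq_left, inv_one]
    rw [one_div]; exact (one_le_inv₀ h).2 h1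

/-- The region `D = {(y, t) ∈ ℝⁿ × (0, ∞) : t < m(y)}`. -/
def region (n : ℕ) : Set (EuclideanSpace ℝ (Fin n) × ℝ) :=
  {z | 0 < z.2 ∧ z.2 < adm z.1}

/-- The measure `dγ(y) dt/t` on `D`. -/
def regionMeasure (n : ℕ) : Measure (region n) :=
  ((gaussian n).prod
    ((volume.restrict (Ioi (0 : ℝ))).withDensity fun t => ENNReal.ofReal (1 / t))).comap
    Subtype.val

/-- `(J f(x))(y, t) = 1_{B(y,t)}(x) γ(B(y,t))^(-1/q) f(y, t)`. -/
def tentJ {n : ℕ} (q : ℝ) (f : region n → ℂ) (x : EuclideanSpace ℝ (Fin n)) (z : region n) : ℂ :=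
  (Metric.ball z.1.1 z.1.2).indicator
    (fun _ => (((((gaussian n).real (Metric.ball z.1.1 z.1.2)) ^ (1 / q))⁻¹ : ℝ) : ℂ) * f z) x

/-- The norm of `J f` in `L¹(γ; L^q(D, dγ(y) dt/t))`, with values in `[0, ∞]`, for an arbitrary
(measurable) function `f` on `D`. -/
def tentENorm {n : ℕ} (q : ℝ) (f : region n → ℂ) : ℝ≥0∞ :=
  ∫⁻ x, eLpNorm (tentJ q f x) (ENNReal.ofReal q) (regionMeasure n) ∂(gaussian n)

/-! Facts needed to see that this is a seminorm, with finite values, on `C_c(D)`. -/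

instance instIsFiniteMeasureGaussian (n : ℕ) : IsFiniteMeasure (gaussian n) := by
  refine isFiniteMeasure_withDensity_ofReal ?_
  have h := GaussianFourier.integrable_cexp_neg_mul_sq_norm_add
    (V := EuclideanSpace ℝ (Fin n)) (b := (1 / 2 : ℂ)) (by norm_num) 0 0
  have h2 := (h.norm).const_mul ((2 * Real.pi) ^ (-(n : ℝ) / 2))
  refine Integrable.hasFiniteIntegral (h2.congr (ae_of_all _ fun x => ?_))
  simp only [Complex.norm_exp]
  congr 2
  simp [← Complex.ofReal_pow]
  ring

instance instIsOpenPosMeasureGaussian (n : ℕ) : (gaussian n).IsOpenPosMeasure := by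
  refine Measure.AbsolutelyContinuous.isOpenPosMeasure (μ := volume)
    (withDensity_absolutelyContinuous' ?_ (ae_of_all _ fun x => ?_))
  · exact (by fun_prop : Measurable _).aemeasurable
  · have : 0 < (2 * Real.pi) ^ (-(n : ℝ) / 2) * Real.exp (-(‖x‖ ^ 2) / 2) := by positivity
    exact (ENNReal.ofReal_pos.2 this).ne'

theorem isOpen_region (n : ℕ) : IsOpen (region n) := by
  have h : Continuous fun z : EuclideanSpace ℝ (Fin n) × ℝ => adm z.1 := by
    unfold adm
    refine Continuous.inv₀ (by fun_prop) fun z => ?_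
    positivity
  exact (isOpen_lt continuous_const continuous_snd).inter (isOpen_lt continuous_snd h)

theorem measure_lt_top_of_isCompact {n : ℕ} {K : Set (region n)} (hK : IsCompact K) :
    regionMeasure n K < ∞ := by
  obtain ⟨c, hc, hcK⟩ : ∃ c : ℝ, 0 < c ∧ ∀ z ∈ K, c ≤ z.1.2 := by
    rcases K.eq_empty_or_nonempty with rfl | hne
    · exact ⟨1, one_pos, by simp⟩
    · obtain ⟨z, -, hz⟩ := hK.exists_isMinOn hne
        (f := fun z : region n => z.1.2) (by fun_prop)
      exact ⟨z.1.2, z.2.1, fun w hw => hz hw⟩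
  have hle : ∀ z : region n, z.1.2 ≤ 1 := fun z =>
    z.2.2.le.trans (inv_le_one_of_one_le₀ (le_max_left _ _))
  have hemb := MeasurableEmbedding.subtype_coe (isOpen_region n).measurableSet
  unfold regionMeasure
  rw [hemb.comap_apply]
  have hsub : (Subtype.val '' K : Set (EuclideanSpace ℝ (Fin n) × ℝ)) ⊆ univ ×ˢ Icc c 1 := by
    rintro _ ⟨z, hz, rfl⟩
    exact ⟨mem_univ _, hcK z hz, hle z⟩
  refine (measure_mono hsub).trans_lt ?_
  rw [Measure.prod_prod]
  refine ENNReal.mul_lt_top (measure_lt_top _ _) ?_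
  rw [withDensity_apply _ measurableSet_Icc, Measure.restrict_restrict measurableSet_Icc]
  calc ∫⁻ t in Icc c 1 ∩ Ioi 0, ENNReal.ofReal (1 / t)
      ≤ ∫⁻ t in Icc c 1 ∩ Ioi 0, ENNReal.ofReal (1 / c) := by
        refine setLIntegral_mono' (measurableSet_Icc.inter measurableSet_Ioi) fun t ht => ?_
        exact ENNReal.ofReal_le_ofReal (one_div_le_one_div_of_le hc ht.1.1)
    _ < ∞ := by
        rw [setLIntegral_const]
        exact ENNReal.mul_lt_top ENNReal.ofReal_lt_top
          ((measure_mono inter_subset_left).trans_lt measure_Icc_lt_top)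

instance instSFiniteRegionMeasure (n : ℕ) : SFinite (regionMeasure n) := by
  have : LocallyCompactSpace (region n) := (isOpen_region n).locallyCompactSpace
  have : IsFiniteMeasureOnCompacts (regionMeasure n) :=
    ⟨fun _ hK => measure_lt_top_of_isCompact hK⟩
  infer_instance

theorem measurableSet_ball_indicator (n : ℕ) :
    MeasurableSet {p : EuclideanSpace ℝ (Fin n) × region n |
      p.1 ∈ Metric.ball p.2.1.1 p.2.1.2} :=
  (isOpen_lt (f := fun p : EuclideanSpace ℝ (Fin n) × region n => dist p.1 p.2.1.1)
    (g := fun p => p.2.1.2) (by fun_prop) (by fun_prop)).measurableSet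

theorem measurable_tentJ {n : ℕ} (q : ℝ) {f : region n → ℂ} (hf : Measurable f) :
    Measurable fun p : EuclideanSpace ℝ (Fin n) × region n => tentJ q f p.1 p.2 := by
  have hb : Measurable fun z : region n => (gaussian n).real (Metric.ball z.1.1 z.1.2) := by
    have hs : MeasurableSet {p : region n × EuclideanSpace ℝ (Fin n) |
        p.2 ∈ Metric.ball p.1.1.1 p.1.1.2} :=
      (isOpen_lt (f := fun p : region n × EuclideanSpace ℝ (Fin n) => dist p.2 p.1.1.1)
        (g := fun p => p.1.1.2) (by fun_prop) (by fun_prop)).measurableSet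
    exact (measurable_measure_prodMk_left (ν := gaussian n) hs).ennreal_toReal
  have hg : Measurable fun p : EuclideanSpace ℝ (Fin n) × region n =>
      (((((gaussian n).real (Metric.ball p.2.1.1 p.2.1.2)) ^ (1 / q))⁻¹ : ℝ) : ℂ) * f p.2 := by
    refine Measurable.mul ?_ (hf.comp measurable_snd)
    exact Complex.measurable_ofReal.comp ((hb.comp measurable_snd).pow_const _).inv
  exact hg.indicator (measurableSet_ball_indicator n)

theorem measurable_eLpNorm_tentJ {n : ℕ} {q : ℝ} (hq : 1 < q) {f : region n → ℂ}
    (hf : Measurable f) :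
    Measurable fun x => eLpNorm (tentJ q f x) (ENNReal.ofReal q) (regionMeasure n) := by
  have h0 : ENNReal.ofReal q ≠ 0 := (ENNReal.ofReal_pos.2 (by linarith)).ne'
  simp only [eLpNorm_eq_lintegral_rpow_enorm_toReal h0 ENNReal.ofReal_ne_top]
  refine Measurable.pow_const ?_ _
  exact Measurable.lintegral_prod_right' (((measurable_tentJ q hf).enorm).pow_const _)

theorem tentENorm_add_le {n : ℕ} {q : ℝ} (hq : 1 < q) {f g : region n → ℂ}
    (hf : Measurable f) (hg : Measurable g) :
    tentENorm q (f + g) ≤ tentENorm q f + tentENorm q g := by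
  unfold tentENorm
  rw [← lintegral_add_left (measurable_eLpNorm_tentJ hq hf)]
  refine lintegral_mono fun x => ?_
  have h1 : tentJ q (f + g) x = tentJ q f x + tentJ q g x := by
    funext z
    simp only [tentJ, Pi.add_apply, indicator]
    split_ifs <;> ring
  rw [h1]
  refine eLpNorm_add_le ?_ ?_ (by rw [← ENNReal.ofReal_one]; exact ENNReal.ofReal_le_ofReal hq.le)
  · exact ((measurable_tentJ q hf).comp measurable_prodMk_left).aestronglyMeasurable
  · exact ((measurable_tentJ q hg).comp measurable_prodMk_left).aestronglyMeasurable

theorem tentENorm_smul {n : ℕ} {q : ℝ} (hq : 1 < q) (c : ℂ) {f : region n → ℂ}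
    (hf : Measurable f) : tentENorm q (c • f) = ‖c‖ₑ * tentENorm q f := by
  unfold tentENorm
  rw [← lintegral_const_mul _ (measurable_eLpNorm_tentJ hq hf)]
  refine lintegral_congr fun x => ?_
  rw [← eLpNorm_const_smul]
  congr 1
  funext z
  simp only [tentJ, Pi.smul_apply, indicator, smul_eq_mul]
  split_ifs <;> ring

theorem exists_le_gaussian_ball {n : ℕ} {K : Set (region n)} (hK : IsCompact K) :
    ∃ c : ℝ, 0 < c ∧ ∀ z ∈ K, c ≤ (gaussian n).real (Metric.ball z.1.1 z.1.2) := by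
  refine hK.induction_on (p := fun s => ∃ c : ℝ, 0 < c ∧
    ∀ z ∈ s, c ≤ (gaussian n).real (Metric.ball z.1.1 z.1.2)) ⟨1, one_pos, by simp⟩
    (fun s t hst ⟨c, hc, h⟩ => ⟨c, hc, fun z hz => h z (hst hz)⟩) ?_ ?_
  · rintro s t ⟨c, hc, h⟩ ⟨d, hd, h'⟩
    refine ⟨min c d, lt_min hc hd, fun z hz => ?_⟩
    rcases hz with hz | hz
    · exact (min_le_left _ _).trans (h z hz)
    · exact (min_le_right _ _).trans (h' z hz)
  · intro z _
    have hz : 0 < z.1.2 := z.2.1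
    refine ⟨{w | dist z.1.1 w.1.1 + z.1.2 / 2 < w.1.2}, ?_,
      (gaussian n).real (Metric.ball z.1.1 (z.1.2 / 2)), ?_, ?_⟩
    · refine mem_nhdsWithin_of_mem_nhds (IsOpen.mem_nhds (isOpen_lt (by fun_prop) (by fun_prop)) ?_)
      simp only [mem_ofPred_eq, dist_self, zero_add]
      linarith
    · exact ENNReal.toReal_pos
        (Metric.isOpen_ball.measure_pos _ (Metric.nonempty_ball.2 (by linarith))).ne'
        (measure_ne_top _ _)
    · intro w hw
      refine measureReal_mono (Metric.ball_subset_ball' ?_) (measure_ne_top _ _)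
      simp only [mem_ofPred_eq] at hw
      linarith

theorem tentENorm_lt_top {n : ℕ} {q : ℝ} (hq : 1 < q) (f : C_c(region n, ℂ)) :
    tentENorm q f < ∞ := by
  have hK : IsCompact (tsupport f) := f.hasCompactSupport
  obtain ⟨c, hc, hcK⟩ := exists_le_gaussian_ball hK
  obtain ⟨M, hM⟩ := f.hasCompactSupport.exists_bound_of_continuous f.continuous
  have hp : (0 : ℝ) < 1 / q := by positivity
  have hfin : eLpNorm ((tsupport f).indicator fun _ => (c ^ (1 / q))⁻¹ * M)
      (ENNReal.ofReal q) (regionMeasure n) < ∞ :=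
    (memLp_indicator_const _ hK.measurableSet _
      (Or.inr (measure_lt_top_of_isCompact hK).ne)).eLpNorm_lt_top
  have hbd : ∀ x, eLpNorm (tentJ q f x) (ENNReal.ofReal q) (regionMeasure n) ≤
      eLpNorm ((tsupport f).indicator fun _ => (c ^ (1 / q))⁻¹ * M)
        (ENNReal.ofReal q) (regionMeasure n) := by
    intro x
    refine eLpNorm_mono_real fun z => ?_
    have hM0 : 0 ≤ M := (norm_nonneg _).trans (hM z)
    by_cases hz : z ∈ tsupport f
    · rw [indicator_of_mem hz]
      have hcz := hcK z hz
      refine (norm_indicator_le_norm_self _ _).trans ?_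
      rw [norm_mul, Complex.norm_real, Real.norm_of_nonneg (by positivity)]
      gcongr
      exact hM z
    · have : f z = 0 := image_eq_zero_of_notMem_tsupport hz
      simp [tentJ, this, indicator_of_notMem hz]
  calc tentENorm q f ≤ ∫⁻ _, eLpNorm ((tsupport f).indicator fun _ => (c ^ (1 / q))⁻¹ * M)
        (ENNReal.ofReal q) (regionMeasure n) ∂(gaussian n) := lintegral_mono hbd
    _ < ∞ := by
      rw [lintegral_const]
      exact ENNReal.mul_lt_top hfin (measure_lt_top _ _)

/-- `C_c(D)`, to be equipped with the norm of `T^{1,q}(γ)`. -/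
def TentCore (n : ℕ) (_q : ℝ) : Type := C_c(region n, ℂ)

instance instAddCommGroupTentCore (n : ℕ) (q : ℝ) : AddCommGroup (TentCore n q) :=
  inferInstanceAs (AddCommGroup C_c(region n, ℂ))

instance instModuleTentCore (n : ℕ) (q : ℝ) : Module ℂ (TentCore n q) :=
  inferInstanceAs (Module ℂ C_c(region n, ℂ))

/-- The function on `D` underlying an element of `C_c(D)`. -/
def TentCore.toFun {n : ℕ} {q : ℝ} (f : TentCore n q) : region n → ℂ :=
  fun z => (show C_c(region n, ℂ) from f) z

/-- The norm `‖f‖_{T^{1,q}(γ)}` on `C_c(D)`. -/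
instance instNormTentCore (n : ℕ) (q : ℝ) : Norm (TentCore n q) :=
  ⟨fun f => (tentENorm q f.toFun).toReal⟩

theorem tentCore_seminormedSpaceCore (n : ℕ) (q : ℝ) [hq : Fact (1 < q)] :
    SeminormedSpace.Core ℂ (TentCore n q) where
  norm_nonneg _ := ENNReal.toReal_nonneg
  norm_smul c f := by
    have hm : Measurable f.toFun := (show C_c(region n, ℂ) from f).continuous.measurable
    change (tentENorm q (c • f.toFun)).toReal = _
    rw [tentENorm_smul hq.out c hm, ENNReal.toReal_mul, toReal_enorm]
    rfl
  norm_triangle f g := by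
    have hf : Measurable f.toFun := (show C_c(region n, ℂ) from f).continuous.measurable
    have hg : Measurable g.toFun := (show C_c(region n, ℂ) from g).continuous.measurable
    have h1 : tentENorm q f.toFun ≠ ∞ := (tentENorm_lt_top hq.out (n := n) f).ne
    have h2 : tentENorm q g.toFun ≠ ∞ := (tentENorm_lt_top hq.out (n := n) g).ne
    change (tentENorm q (f.toFun + g.toFun)).toReal ≤
      (tentENorm q f.toFun).toReal + (tentENorm q g.toFun).toReal
    rw [← ENNReal.toReal_add h1 h2]
    exact ENNReal.toReal_mono (ENNReal.add_ne_top.2 ⟨h1, h2⟩) (tentENorm_add_le hq.out hf hg)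

instance instSeminormedAddCommGroupTentCore (n : ℕ) (q : ℝ) [Fact (1 < q)] :
    SeminormedAddCommGroup (TentCore n q) :=
  SeminormedAddCommGroup.ofCore (tentCore_seminormedSpaceCore n q)

instance instNormedSpaceTentCore (n : ℕ) (q : ℝ) [Fact (1 < q)] :
    NormedSpace ℂ (TentCore n q) where
  norm_smul_le c f := ((tentCore_seminormedSpaceCore n q).norm_smul c f).le

/-- The Gaussian tent space `T^{1,q}(γ)`: the completion of `C_c(D)` with respect to
`‖·‖_{T^{1,q}(γ)}`. -/
abbrev TentSpace (n : ℕ) (q : ℝ) [Fact (1 < q)] : Type :=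
  UniformSpace.Completion (TentCore n q)

/-- The measurable function `u : D → ℂ` belongs to `T^{1,q}(γ)` and is the element `F` of it:
`F` is the limit in the completion of some sequence in `C_c(D)` that also converges to `u` with
respect to the norm of `L¹(γ; L^q(D))` (applied to `J`). -/
def Represents {n : ℕ} {q : ℝ} [Fact (1 < q)] (u : region n → ℂ) (F : TentSpace n q) : Prop :=
  AEStronglyMeasurable u (regionMeasure n) ∧
    ∃ g : ℕ → TentCore n q,
      Tendsto (fun k => tentENorm q (u - (g k).toFun)) atTop (𝓝 0) ∧
      Tendsto (fun k => (g k : TentSpace n q)) atTop (𝓝 F)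

/-- The tent with aperture `β` over `A`: the set of all `(y, t) ∈ ℝⁿ × (0, ∞)` with
`d(y, Aᶜ) ≥ β t`. -/
def tent {n : ℕ} (β : ℝ) (A : Set (EuclideanSpace ℝ (Fin n))) :
    Set (EuclideanSpace ℝ (Fin n) × ℝ) :=
  {z | 0 < z.2 ∧ ENNReal.ofReal (β * z.2) ≤ Metric.infEDist z.1 Aᶜ}

/-- `T^{1,q}(γ)` `α`-atoms: functions on `D` supported in the tent `T_1(B)` over a ball
`B = B(c, r)` that is admissible at scale `α`, with `‖a‖_{L^q(D, dγ dt/t)} ≤ γ(B)^(-1/q')`, where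
`1/q' = 1 - 1/q`. -/
def IsAtom {n : ℕ} (q α : ℝ) (a : region n → ℂ) : Prop :=
  AEStronglyMeasurable a (regionMeasure n) ∧
    ∃ (c : EuclideanSpace ℝ (Fin n)) (r : ℝ), 0 ≤ r ∧ r ≤ α * adm c ∧
      (∀ z : region n, (z : EuclideanSpace ℝ (Fin n) × ℝ) ∉ tent 1 (Metric.ball c r) → a z = 0) ∧
      eLpNorm a (ENNReal.ofReal q) (regionMeasure n) ≤
        gaussian n (Metric.ball c r) ^ (-(1 - 1 / q))

end GaussianTent

end

open GaussianTent

/-! The proof is a stopping-time argument for a dyadic square function. A point `(y, t)` of `D` with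
`2^(-i) ≤ t < 2^(1-i)` is tagged with the dyadic cube `Q` of side `2^(-i-κ)` containing `y`. The
sum, over the cubes `Q` containing `x`, of the `|f|^q`-mass tagged by `Q` divided by `γ(Q)` is the
`q`-th power of a square function `S`. Since `Q ⊆ B(y, t)` and the Gaussian density is nearly
constant at scale `m(y)`, the two have comparable measure and `S(x) ≤ C ‖J f(x)‖`
(`tsum_cellDensity_le_tentJ`).

For each `k`, stop at the first generation whose partial sum exceeds `2^(kq)`. The points of `D`
above a stopping cube whose partial sum, up to their own generation, is at most `2^((k+1)q)` form
one region. Partial sums are constant on cubes, so no maximal function or Whitney covering is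
needed. The regions are disjoint, exhaust the mass of `f`, and carry mass at most `2^((k+1)q) γ(Q)`
(`massMeasure_stopRegion_le`). The stopping generation contributes mass, so `Q` tags a point of `D`.
This makes `Q` admissible and puts the region in the tent over an admissible ball comparable to `Q`
(`exists_ball_stopRegion`). The coefficients `C 2^(k+1) γ(Q)` sum to at most a multiple of `∑
2^(k+1) γ {S > 2^k} ≤ 4 ∫ S dγ`.

For `f` in `C_c(D)` the series converges in `L^q(D)`, hence in the tent space because `γ` is finite.
A general element is an absolutely convergent series of such functions. -/

namespace GaussianTent

/-! ### The tent norm against the `L^q` norm. -/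

variable {n : ℕ} {q : ℝ}

theorem gaussian_ball_pos (z : region n) : 0 < gaussian n (Metric.ball z.1.1 z.1.2) :=
  Metric.isOpen_ball.measure_pos _ (Metric.nonempty_ball.2 z.2.1)

theorem enorm_tentJ_rpow (hq : 1 < q) (f : region n → ℂ) (x : EuclideanSpace ℝ (Fin n))
    (z : region n) :
    ‖tentJ q f x z‖ₑ ^ q = (Metric.ball z.1.1 z.1.2).indicator
      (fun _ => (gaussian n (Metric.ball z.1.1 z.1.2))⁻¹ * ‖f z‖ₑ ^ q) x := by
  have hq0 : 0 < q := by linarith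
  unfold tentJ
  by_cases hx : x ∈ Metric.ball z.1.1 z.1.2
  · rw [indicator_of_mem hx, indicator_of_mem hx, enorm_mul, ENNReal.mul_rpow_of_nonneg _ _ hq0.le]
    congr 1
    have hp : 0 < (gaussian n).real (Metric.ball z.1.1 z.1.2) :=
      ENNReal.toReal_pos (gaussian_ball_pos z).ne' (measure_ne_top _ _)
    rw [← ofReal_norm, Complex.norm_real, Real.norm_of_nonneg (by positivity),
      ENNReal.ofReal_rpow_of_nonneg (by positivity) hq0.le, Real.inv_rpow (by positivity),
      ← Real.rpow_mul hp.le, one_div, inv_mul_cancel₀ hq0.ne', Real.rpow_one,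
      ENNReal.ofReal_inv_of_pos hp, Measure.real, ENNReal.ofReal_toReal (measure_ne_top _ _)]
  · rw [indicator_of_notMem hx, indicator_of_notMem hx, enorm_zero, ENNReal.zero_rpow_of_pos hq0]

theorem eLpNorm_tentJ (hq : 1 < q) (f : region n → ℂ) (x : EuclideanSpace ℝ (Fin n)) :
    eLpNorm (tentJ q f x) (ENNReal.ofReal q) (regionMeasure n) =
      (∫⁻ z : region n, (Metric.ball z.1.1 z.1.2).indicator
        (fun _ => (gaussian n (Metric.ball z.1.1 z.1.2))⁻¹ * ‖f z‖ₑ ^ q) x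
          ∂(regionMeasure n)) ^ (1 / q) := by
  have hq0 : 0 < q := by linarith
  rw [eLpNorm_eq_lintegral_rpow_enorm_toReal (ENNReal.ofReal_pos.2 hq0).ne' ENNReal.ofReal_ne_top,
    ENNReal.toReal_ofReal hq0.le]
  simp only [enorm_tentJ_rpow hq]

/-- Tonelli: the normalised indicator of `B(y, t)` has `γ`-integral one in `x`. -/
theorem lintegral_eLpNorm_tentJ_rpow (hq : 1 < q) {f : region n → ℂ} (hf : Measurable f) :
    ∫⁻ x, eLpNorm (tentJ q f x) (ENNReal.ofReal q) (regionMeasure n) ^ q ∂(gaussian n) =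
      eLpNorm f (ENNReal.ofReal q) (regionMeasure n) ^ q := by
  have hq0 : 0 < q := by linarith
  have h (u : region n → ℂ) : eLpNorm u (ENNReal.ofReal q) (regionMeasure n) ^ q =
      ∫⁻ z, ‖u z‖ₑ ^ q ∂(regionMeasure n) := by
    rw [eLpNorm_eq_lintegral_rpow_enorm_toReal (ENNReal.ofReal_pos.2 hq0).ne' ENNReal.ofReal_ne_top,
      ENNReal.toReal_ofReal hq0.le, one_div, ENNReal.rpow_inv_rpow hq0.ne']
  simp only [h]
  rw [lintegral_lintegral_swap]
  · refine lintegral_congr fun z => ?_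
    simp only [enorm_tentJ_rpow hq]
    rw [lintegral_indicator_const Metric.isOpen_ball.measurableSet, mul_right_comm,
      ENNReal.inv_mul_cancel (gaussian_ball_pos z).ne' (measure_ne_top _ _), one_mul]
  · exact ((measurable_tentJ q hf).enorm.pow_const _).aemeasurable

/-- A function supported in a tent over `B` has tent norm controlled by its `L^q` norm. -/
theorem tentENorm_le_eLpNorm (hq : 1 < q) {f : region n → ℂ} (hf : Measurable f)
    {B : Set (EuclideanSpace ℝ (Fin n))} (hB : MeasurableSet B)
    (h : ∀ z, f z ≠ 0 → Metric.ball z.1.1 z.1.2 ⊆ B) :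
    tentENorm q f ≤
      gaussian n B ^ (1 - 1 / q) * eLpNorm f (ENNReal.ofReal q) (regionMeasure n) := by
  have hq0 : 0 < q := by linarith
  set G := fun x => eLpNorm (tentJ q f x) (ENNReal.ofReal q) (regionMeasure n) with hG
  have hGm : Measurable G := measurable_eLpNorm_tentJ hq hf
  have hsupp : ∀ x, x ∉ B → G x = 0 := by
    intro x hx
    have : tentJ q f x = 0 := by
      funext z
      by_cases hz : f z = 0
      · simp [tentJ, hz]
      · exact indicator_of_notMem (fun hxz => hx (h z hz hxz)) _
    simp [hG, this]
  have hGB : ∀ x, G x = B.indicator 1 x * G x := by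
    intro x
    by_cases hx : x ∈ B
    · simp [hx]
    · simp [hx, hsupp x hx]
  have hconj : (1 - 1 / q)⁻¹.HolderConjugate q := by
    refine (Real.holderConjugate_iff.2 ⟨(one_lt_inv₀ ?_).2 ?_, ?_⟩)
    · rw [sub_pos, div_lt_one hq0]; exact hq
    · have : 0 < 1 / q := by positivity
      linarith
    · rw [inv_inv, one_div]; ring
  have hpos : 0 < (1 - 1 / q)⁻¹ := hconj.pos
  -- `J f(x)` vanishes for `x` outside `B`, so this is Hölder against the indicator of `B`, with
  -- conjugate exponent `(1 - 1 / q)⁻¹`.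
  calc tentENorm q f = ∫⁻ x, ((B.indicator 1 : _ → ℝ≥0∞) * G) x ∂(gaussian n) :=
        lintegral_congr fun x => hGB x
    _ ≤ (∫⁻ x, (B.indicator 1 x) ^ (1 - 1 / q)⁻¹ ∂(gaussian n)) ^ (1 / (1 - 1 / q)⁻¹) *
          (∫⁻ x, G x ^ q ∂(gaussian n)) ^ (1 / q) :=
        ENNReal.lintegral_mul_le_Lp_mul_Lq _ hconj
          (measurable_one.indicator hB).aemeasurable hGm.aemeasurable
    _ = _ := by
        congr 1
        · rw [one_div (1 - 1 / q)⁻¹, inv_inv]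
          congr 1
          rw [← lintegral_indicator_one hB]
          refine lintegral_congr fun x => ?_
          by_cases hx : x ∈ B
          · simp [hx]
          · simp only [indicator_of_notMem hx, ENNReal.zero_rpow_of_pos hpos]
        · rw [lintegral_eLpNorm_tentJ_rpow hq hf, one_div, ENNReal.rpow_rpow_inv hq0.ne']

theorem tentENorm_le_univ (hq : 1 < q) {f : region n → ℂ} (hf : Measurable f) :
    tentENorm q f ≤
      gaussian n univ ^ (1 - 1 / q) * eLpNorm f (ENNReal.ofReal q) (regionMeasure n) :=
  tentENorm_le_eLpNorm hq hf MeasurableSet.univ fun _ _ => subset_univ _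

/-! ### Functions that represent elements of the completion. -/

theorem TentCore.continuous_toFun (g : TentCore n q) : Continuous g.toFun :=
  (show C_c(region n, ℂ) from g).continuous

theorem TentCore.memLp_toFun (g : TentCore n q) :
    MemLp g.toFun (ENNReal.ofReal q) (regionMeasure n) := by
  have : IsFiniteMeasureOnCompacts (regionMeasure n) :=
    ⟨fun _ hK => measure_lt_top_of_isCompact hK⟩
  exact g.continuous_toFun.memLp_of_hasCompactSupport
    (show C_c(region n, ℂ) from g).hasCompactSupport

theorem tentENorm_sub_comm {u v : region n → ℂ} :
    tentENorm q (u - v) = tentENorm q (v - u) := by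
  unfold tentENorm
  refine lintegral_congr fun x => ?_
  rw [← eLpNorm_neg]
  congr 1
  funext z
  simp only [tentJ, Pi.neg_apply, Pi.sub_apply, indicator]
  split_ifs <;> ring

theorem tentENorm_zero : tentENorm q (0 : region n → ℂ) = 0 := by
  have : ∀ x, tentJ q (0 : region n → ℂ) x = 0 := fun x => by funext z; simp [tentJ]
  simp [tentENorm, this]

variable [hq : Fact (1 < q)]

theorem TentCore.enorm_def (g : TentCore n q) :
    ‖(g : TentSpace n q)‖ₑ = tentENorm q g.toFun := by
  rw [← ofReal_norm, UniformSpace.Completion.norm_coe]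
  exact ENNReal.ofReal_toReal (tentENorm_lt_top hq.out (n := n) g).ne

theorem Represents.add {u v : region n → ℂ} {F G : TentSpace n q} (hum : Measurable u)
    (hvm : Measurable v) (hu : Represents u F) (hv : Represents v G) :
    Represents (u + v) (F + G) := by
  obtain ⟨hu1, g, hg, hgF⟩ := hu
  obtain ⟨hv1, h, hh, hhG⟩ := hv
  refine ⟨hu1.add hv1, fun k => g k + h k, ?_, ?_⟩
  · refine tendsto_of_tendsto_of_tendsto_of_le_of_le tendsto_const_nhds
      (by simpa using hg.add hh) (fun _ => zero_le) fun k => ?_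
    have : u + v - (g k + h k).toFun = (u - (g k).toFun) + (v - (h k).toFun) := by
      change u + v - ((g k).toFun + (h k).toFun) = _
      abel
    rw [this]
    exact tentENorm_add_le hq.out (hum.sub (g k).continuous_toFun.measurable)
      (hvm.sub (h k).continuous_toFun.measurable)
  · simpa only [UniformSpace.Completion.coe_add] using hgF.add hhG

theorem Represents.smul {u : region n → ℂ} {F : TentSpace n q} (hum : Measurable u)
    (hu : Represents u F) (c : ℂ) : Represents (c • u) (c • F) := by
  obtain ⟨hu1, g, hg, hgF⟩ := hu
  refine ⟨hu1.const_smul c, fun k => c • g k, ?_, ?_⟩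
  · have h (k : ℕ) : tentENorm q (c • u - (c • g k).toFun) =
        ‖c‖ₑ * tentENorm q (u - (g k).toFun) := by
      rw [← tentENorm_smul hq.out c (hum.sub (g k).continuous_toFun.measurable), smul_sub]
      rfl
    simp only [h]
    simpa using ENNReal.Tendsto.const_mul hg (Or.inr (by simp : ‖c‖ₑ ≠ ∞))
  · simpa only [UniformSpace.Completion.coe_smul] using hgF.const_smul c

theorem represents_coe (g : TentCore n q) : Represents g.toFun (g : TentSpace n q) :=
  ⟨g.continuous_toFun.measurable.aestronglyMeasurable, fun _ => g,
    by simp [tentENorm_zero], tendsto_const_nhds⟩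

theorem represents_zero : Represents (0 : region n → ℂ) (0 : TentSpace n q) :=
  represents_coe (0 : TentCore n q)

theorem Represents.sum {ι : Type*} (s : Finset ι) {u : ι → region n → ℂ} {F : ι → TentSpace n q}
    (hum : ∀ i, Measurable (u i)) (hu : ∀ i, Represents (u i) (F i)) :
    Represents (∑ i ∈ s, u i) (∑ i ∈ s, F i) := by
  classical
  induction s using Finset.induction_on with
  | empty => simpa using represents_zero
  | insert i s hi ih =>
    rw [Finset.sum_insert hi, Finset.sum_insert hi]
    refine Represents.add (hum i) ?_ (hu i) ih
    convert Finset.measurable_sum s fun i _ => hum i using 1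
    ext z
    simp

theorem Represents.enorm_le {u : region n → ℂ} {F : TentSpace n q} (hum : Measurable u)
    (hu : Represents u F) : ‖F‖ₑ ≤ tentENorm q u := by
  obtain ⟨-, g, hg, hgF⟩ := hu
  refine le_of_tendsto_of_tendsto (b := atTop) hgF.enorm
    (by simpa using hg.const_add (tentENorm q u)) (Eventually.of_forall fun k => ?_)
  simp only
  rw [TentCore.enorm_def]
  have h : (g k).toFun = u + ((g k).toFun - u) := by abel
  rw [tentENorm_sub_comm]
  conv_lhs => rw [h]
  exact tentENorm_add_le hq.out hum ((g k).continuous_toFun.measurable.sub hum)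

/-- `C_c(D)` is dense in `L^q(D)`, and `tentENorm_le_univ` turns `L^q` approximation into
approximation in the tent norm. -/
theorem exists_represents {u : region n → ℂ} (hum : Measurable u)
    (hu : MemLp u (ENNReal.ofReal q) (regionMeasure n)) : ∃ F : TentSpace n q, Represents u F := by
  have : LocallyCompactSpace (region n) := (isOpen_region n).locallyCompactSpace
  have : IsFiniteMeasureOnCompacts (regionMeasure n) :=
    ⟨fun _ hK => measure_lt_top_of_isCompact hK⟩
  have key : ∀ k : ℕ, ∃ g : TentCore n q,
      eLpNorm (u - g.toFun) (ENNReal.ofReal q) (regionMeasure n) ≤ ((k : ℝ≥0∞) + 1)⁻¹ := by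
    intro k
    obtain ⟨g, hgs, hg, hgc, -⟩ := hu.exists_hasCompactSupport_eLpNorm_sub_le
      ENNReal.ofReal_ne_top (ε := ((k : ℝ≥0∞) + 1)⁻¹) (by simp)
    exact ⟨(⟨⟨g, hgc⟩, hgs⟩ : C_c(region n, ℂ)), hg⟩
  choose g hg using key
  have hlim0 : Tendsto (fun k : ℕ => gaussian n univ ^ (1 - 1 / q) * ((k : ℝ≥0∞) + 1)⁻¹) atTop
      (𝓝 0) := by
    have h1 : Tendsto (fun k : ℕ => ((k : ℝ≥0∞) + 1)⁻¹) atTop (𝓝 0) := by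
      have := (tendsto_add_atTop_iff_nat 1).2 ENNReal.tendsto_inv_nat_nhds_zero
      simpa using this
    have h2 : gaussian n univ ^ (1 - 1 / q) ≠ ∞ :=
      ENNReal.rpow_ne_top_of_nonneg (by
        rw [sub_nonneg, div_le_one (by linarith [hq.out])]; exact hq.out.le) (measure_ne_top _ _)
    simpa using ENNReal.Tendsto.const_mul h1 (Or.inr h2)
  have hgm (k : ℕ) := (g k).continuous_toFun.measurable
  have hle (k : ℕ) : tentENorm q (u - (g k).toFun) ≤
      gaussian n univ ^ (1 - 1 / q) * ((k : ℝ≥0∞) + 1)⁻¹ :=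
    (tentENorm_le_univ hq.out (hum.sub (hgm k))).trans (mul_le_mul_right (hg k) _)
  have hlim : Tendsto (fun k => tentENorm q (u - (g k).toFun)) atTop (𝓝 0) :=
    tendsto_of_tendsto_of_tendsto_of_le_of_le tendsto_const_nhds hlim0 (fun _ => zero_le) hle
  have hcauchy : CauchySeq fun k => (g k : TentSpace n q) := by
    rw [EMetric.cauchySeq_iff]
    intro ε hε
    obtain ⟨N, hN⟩ := eventually_atTop.1 (hlim.eventually (gt_mem_nhds (ENNReal.half_pos hε.ne')))
    refine ⟨N, fun k hk l hl => ?_⟩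
    rw [edist_eq_enorm_sub, ← UniformSpace.Completion.coe_sub, TentCore.enorm_def]
    have h : (g k - g l).toFun = ((g k).toFun - u) + (u - (g l).toFun) := by
      change (g k).toFun - (g l).toFun = _
      abel
    rw [h]
    refine (tentENorm_add_le hq.out ((hgm k).sub hum) (hum.sub (hgm l))).trans_lt ?_
    rw [tentENorm_sub_comm, ← ENNReal.add_halves ε]
    exact ENNReal.add_lt_add (hN k hk) (hN l hl)
  obtain ⟨F, hF⟩ := cauchySeq_tendsto_of_complete hcauchy
  exact ⟨F, hum.aestronglyMeasurable, g, hlim, hF⟩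

theorem ball_subset_of_mem_tent {c : EuclideanSpace ℝ (Fin n)} {r : ℝ}
    {z : EuclideanSpace ℝ (Fin n) × ℝ} (h : z ∈ tent 1 (Metric.ball c r)) :
    Metric.ball z.1 z.2 ⊆ Metric.ball c r := by
  intro x hx
  by_contra hxB
  have h1 : Metric.infEDist z.1 (Metric.ball c r)ᶜ ≤ edist z.1 x :=
    Metric.infEDist_le_edist_of_mem hxB
  have h2 : edist z.1 x < ENNReal.ofReal (1 * z.2) := by
    rw [one_mul, edist_dist, ENNReal.ofReal_lt_ofReal_iff h.1, dist_comm]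
    exact hx
  exact absurd (h.2.trans h1) h2.not_ge

theorem tentENorm_le_one_of_isAtom {α : ℝ} {a : region n → ℂ} (ham : Measurable a)
    (ha : IsAtom q α a) : tentENorm q a ≤ 1 := by
  obtain ⟨-, c, r, -, -, hs, hn⟩ := ha
  have h1 := tentENorm_le_eLpNorm hq.out ham (B := Metric.ball c r)
    Metric.isOpen_ball.measurableSet fun z hz =>
      ball_subset_of_mem_tent (by by_contra hzt; exact hz (hs z hzt))
  refine h1.trans ((mul_le_mul_right hn _).trans ?_)
  rw [ENNReal.rpow_neg]
  -- An inequality, not an equality, so that balls of measure zero are covered.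
  exact ENNReal.mul_inv_le_one _

end GaussianTent

namespace GaussianTent

variable {n : ℕ}

/-! ### The admissible scale and local doubling of the Gaussian measure. -/

theorem adm_pos (x : EuclideanSpace ℝ (Fin n)) : 0 < adm x := by unfold adm; positivity

theorem adm_le_one (x : EuclideanSpace ℝ (Fin n)) : adm x ≤ 1 :=
  inv_le_one_of_one_le₀ (le_max_left _ _)

theorem norm_mul_adm_le (x : EuclideanSpace ℝ (Fin n)) : ‖x‖ * adm x ≤ 1 := by
  unfold adm
  rw [← div_eq_mul_inv, div_le_one (by positivity)]
  exact le_max_right _ _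

/-- `1 / m` is 1-Lipschitz, so `1 / m(y) ≤ 1 / m(x) + δ m(y)`. Multiply by `m(x) m(y)` and use `m(y)
≤ 1`. -/
theorem adm_mul_le {x y : EuclideanSpace ℝ (Fin n)} {δ : ℝ}
    (h : dist x y ≤ δ * adm y) : adm x * (1 - δ) ≤ adm y := by
  have h1 : max 1 ‖y‖ ≤ max 1 ‖x‖ + dist x y := by
    have h2 : ‖y‖ ≤ ‖x‖ + dist x y := by
      rw [dist_comm, dist_eq_norm]; linarith [norm_sub_norm_le y x]
    refine max_le ?_ ?_
    · linarith [le_max_left 1 ‖x‖, dist_nonneg (x := x) (y := y)]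
    · linarith [le_max_right 1 ‖x‖]
  have h3 : adm x * max 1 ‖x‖ = 1 := inv_mul_cancel₀ (by positivity)
  have h4 : adm y * max 1 ‖y‖ = 1 := inv_mul_cancel₀ (by positivity)
  have hx := adm_pos x
  have hy := adm_pos y
  have hy1 := adm_le_one y
  have hd0 : 0 ≤ δ := by
    have := dist_nonneg.trans h
    by_contra hneg
    nlinarith
  have h5 : adm y * (max 1 ‖x‖ + δ * adm y) ≥ 1 := by
    have : max 1 ‖y‖ ≤ max 1 ‖x‖ + δ * adm y := h1.trans (by linarith)
    nlinarith
  have h6 : adm x * adm y * (max 1 ‖x‖ + δ * adm y) ≥ adm x := by nlinarith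
  have h7 : adm x * adm y * (max 1 ‖x‖ + δ * adm y) = adm y + adm x * δ * (adm y * adm y) := by
    calc _ = adm y * (adm x * max 1 ‖x‖) + adm x * δ * (adm y * adm y) := by ring
      _ = _ := by rw [h3, mul_one]
  have h8 : adm x * δ * (adm y * adm y) ≤ adm x * δ := by
    have : adm y * adm y ≤ 1 := by nlinarith
    exact mul_le_of_le_one_right (by positivity) this
  nlinarith

/-- The difference is at most `3m (2‖c‖ + 3m)` with `m = m(c)`, and `‖c‖ m ≤ 1`, `m ≤ 1` give `6 +
9`. Hence the Gaussian density varies by a factor at most `e^15` on such a ball. -/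
theorem abs_norm_sq_sub_le {c x : EuclideanSpace ℝ (Fin n)} (h : dist x c ≤ 3 * adm c) :
    |‖x‖ ^ 2 - ‖c‖ ^ 2| ≤ 15 := by
  have h1 : |‖x‖ - ‖c‖| ≤ 3 * adm c := (abs_norm_sub_norm_le x c).trans (by rwa [← dist_eq_norm])
  have h2 := norm_mul_adm_le c
  have h3 := adm_le_one c
  have h4 := adm_pos c
  have h5 : ‖x‖ ≤ ‖c‖ + 3 * adm c := by linarith [le_abs_self (‖x‖ - ‖c‖)]
  calc |‖x‖ ^ 2 - ‖c‖ ^ 2| = |‖x‖ - ‖c‖| * (‖x‖ + ‖c‖) := by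
        rw [← abs_of_nonneg (by positivity : 0 ≤ ‖x‖ + ‖c‖), ← abs_mul]
        ring_nf
    _ ≤ (3 * adm c) * (2 * ‖c‖ + 3 * adm c) :=
        mul_le_mul h1 (by linarith) (by positivity) (by positivity)
    _ ≤ 15 := by nlinarith

/-- Gaussian measures of comparable balls at the admissible scale are comparable. -/
theorem gaussian_ball_le {c p : EuclideanSpace ℝ (Fin n)} {r ρ a : ℝ} (hr : r ≤ 3 * adm c)
    (ha : 0 < a) (hp : Metric.ball p ρ ⊆ Metric.closedBall c (3 * adm c))
    (hra : r ≤ a * ρ) :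
    gaussian n (Metric.ball c r) ≤
      ENNReal.ofReal (Real.exp 15 * a ^ n) * gaussian n (Metric.ball p ρ) := by
  have hbound : ∀ x y, dist x c ≤ 3 * adm c → dist y c ≤ 3 * adm c →
      Real.exp (-(‖x‖ ^ 2) / 2) ≤ Real.exp 15 * Real.exp (-(‖y‖ ^ 2) / 2) := by
    intro x y hx hy
    rw [← Real.exp_add]
    have h1 := abs_le.1 (abs_norm_sq_sub_le hx)
    have h2 := abs_le.1 (abs_norm_sq_sub_le hy)
    exact Real.exp_le_exp.2 (by linarith)
  set b := (2 * Real.pi) ^ (-(n : ℝ) / 2) with hb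
  have hb0 : 0 ≤ b := by positivity
  have hc : dist c c ≤ 3 * adm c := by rw [dist_self]; linarith [adm_pos c]
  -- The supremum `u` bounds the density above on the first ball, and `e^15` times the density is at
  -- least `u` on the second.
  set u := ⨆ x : Metric.closedBall c (3 * adm c), Real.exp (-(‖x.1‖ ^ 2) / 2)
  have hbdd : BddAbove (range fun x : Metric.closedBall c (3 * adm c) =>
      Real.exp (-(‖x.1‖ ^ 2) / 2)) :=
    ⟨_, by rintro _ ⟨x, rfl⟩; exact hbound x c x.2 hc⟩
  have hne : Nonempty (Metric.closedBall c (3 * adm c)) := ⟨⟨c, hc⟩⟩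
  have hu0 : 0 ≤ u := Real.iSup_nonneg fun _ => (Real.exp_pos _).le
  have hupper : gaussian n (Metric.ball c r) ≤
      ENNReal.ofReal (b * u) * volume (Metric.ball c r) := by
    rw [gaussian, withDensity_apply _ Metric.isOpen_ball.measurableSet, ← setLIntegral_const]
    refine setLIntegral_mono' Metric.isOpen_ball.measurableSet fun x hx => ?_
    refine ENNReal.ofReal_le_ofReal (mul_le_mul_of_nonneg_left ?_ hb0)
    exact le_ciSup hbdd ⟨x, (Metric.mem_ball.1 hx).le.trans hr⟩
  have hlower : ENNReal.ofReal (b * u) * volume (Metric.ball p ρ) ≤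
      ENNReal.ofReal (Real.exp 15) * gaussian n (Metric.ball p ρ) := by
    rw [gaussian, withDensity_apply _ Metric.isOpen_ball.measurableSet,
      ← lintegral_const_mul' _ _ ENNReal.ofReal_ne_top, ← setLIntegral_const]
    refine setLIntegral_mono' Metric.isOpen_ball.measurableSet fun x hx => ?_
    rw [← ENNReal.ofReal_mul (Real.exp_pos _).le]
    refine ENNReal.ofReal_le_ofReal ?_
    rw [mul_left_comm]
    exact mul_le_mul_of_nonneg_left (ciSup_le fun y => hbound y x y.2 (hp hx)) hb0
  have hvol : volume (Metric.ball c r) ≤ ENNReal.ofReal (a ^ n) * volume (Metric.ball p ρ) := by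
    refine (measure_mono (Metric.ball_subset_ball hra)).trans ?_
    rw [Measure.addHaar_ball_mul_of_pos _ _ ha, Measure.addHaar_ball_center _ p]
    simp
  calc _ ≤ ENNReal.ofReal (b * u) * volume (Metric.ball c r) := hupper
    _ ≤ ENNReal.ofReal (b * u) * (ENNReal.ofReal (a ^ n) * volume (Metric.ball p ρ)) := by gcongr
    _ = ENNReal.ofReal (a ^ n) * (ENNReal.ofReal (b * u) * volume (Metric.ball p ρ)) := by ring
    _ ≤ ENNReal.ofReal (a ^ n) * (ENNReal.ofReal (Real.exp 15) * gaussian n (Metric.ball p ρ)) := by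
        gcongr
    _ = _ := by
        rw [ENNReal.ofReal_mul (Real.exp_pos _).le]; ring

/-! ### Dyadic cubes, scales and tents. -/

/-- The index of the dyadic cube of side `2^(-j)` that contains `x`. -/
noncomputable def dyadicIndex (j : ℕ) (x : EuclideanSpace ℝ (Fin n)) : Fin n → ℤ := fun l => ⌊2 ^ j * x l⌋

theorem measurable_dyadicIndex (j : ℕ) : Measurable (dyadicIndex (n := n) j) := by
  unfold dyadicIndex
  fun_prop

theorem dyadicIndex_eq_of_le {i j : ℕ} (hij : i ≤ j) {x y : EuclideanSpace ℝ (Fin n)}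
    (h : dyadicIndex j x = dyadicIndex j y) : dyadicIndex i x = dyadicIndex i y := by
  induction j, hij using Nat.le_induction with
  | base => exact h
  | succ j _ ih =>
    refine ih (funext fun l => ?_)
    -- Nesting of cubes: the parent's index is the integer half of the child's.
    have key (a : ℝ) : ⌊(2 : ℝ) ^ j * a⌋ = ⌊(2 : ℝ) ^ (j + 1) * a⌋ / 2 := by
      rw [pow_succ, mul_right_comm]
      generalize (2 : ℝ) ^ j * a = b
      have h1 := Int.floor_le b
      have h2 := Int.lt_floor_add_one b
      have h3 : 2 * ⌊b⌋ ≤ ⌊b * 2⌋ := Int.le_floor.2 (by push_cast; linarith)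
      have h4 : ⌊b * 2⌋ < 2 * ⌊b⌋ + 2 := Int.floor_lt.2 (by push_cast; linarith)
      omega
    have := congrFun h l
    unfold dyadicIndex at this ⊢
    rw [key, key, this]

theorem dist_le_of_dyadicIndex_eq {j : ℕ} {x y : EuclideanSpace ℝ (Fin n)}
    (h : dyadicIndex j x = dyadicIndex j y) : dist x y ≤ √n * (1 / 2) ^ j := by
  have hl (l : Fin n) : dist (x l) (y l) ≤ (1 / 2) ^ j := by
    have h1 := Int.abs_sub_lt_one_of_floor_eq_floor (congrFun h l)
    rw [← mul_sub, abs_mul, abs_of_pos (by positivity : (0 : ℝ) < 2 ^ j)] at h1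
    rw [Real.dist_eq, one_div, inv_pow]
    exact (le_inv_mul_iff₀ (by positivity)).2 h1.le |>.trans (by simp)
  rw [EuclideanSpace.dist_eq]
  refine Real.sqrt_le_iff.2 ⟨by positivity, ?_⟩
  calc ∑ l, dist (x l) (y l) ^ 2 ≤ ∑ _l : Fin n, ((1 / 2 : ℝ) ^ j) ^ 2 := by
        gcongr with l; exact hl l
    _ = _ := by
        rw [mul_pow, Real.sq_sqrt (by positivity)]; simp

/-- Each dyadic cube of side `2^(-j)` contains a ball of radius `2^(-j-1)`. -/
theorem exists_ball_subset_dyadic (j : ℕ) (v : Fin n → ℤ) :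
    ∃ p, Metric.ball p ((1 / 2) ^ (j + 1)) ⊆ dyadicIndex (n := n) j ⁻¹' {v} := by
  refine ⟨WithLp.toLp 2 fun l => ((v l : ℝ) + 1 / 2) * (1 / 2) ^ j, fun x hx => ?_⟩
  refine funext fun l => Int.floor_eq_iff.2 ?_
  have h1 : |x l - ((v l : ℝ) + 1 / 2) * (1 / 2) ^ j| < (1 / 2) ^ (j + 1) := by
    refine lt_of_le_of_lt ?_ (Metric.mem_ball.1 hx)
    rw [dist_eq_norm]
    exact PiLp.norm_apply_le (x - WithLp.toLp 2 fun l => ((v l : ℝ) + 1 / 2) * (1 / 2) ^ j) l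
  have h2 : (2 : ℝ) ^ j * (1 / 2) ^ j = 1 := by rw [← mul_pow]; norm_num
  have h3 : (0 : ℝ) < 2 ^ j := by positivity
  rw [pow_succ, abs_lt] at h1
  obtain ⟨ha, hb⟩ := h1
  have h4 : (2 : ℝ) ^ j * (((v l : ℝ) + 1 / 2) * (1 / 2) ^ j) = v l + 1 / 2 := by
    linear_combination ((v l : ℝ) + 1 / 2) * h2
  have ha' := mul_lt_mul_of_pos_left ha h3
  have hb' := mul_lt_mul_of_pos_left hb h3
  constructor <;> linarith

theorem exists_pow_le (z : region n) : ∃ i : ℕ, (1 / 2 : ℝ) ^ i ≤ z.1.2 := by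
  obtain ⟨i, hi⟩ := exists_pow_lt_of_lt_one z.2.1 (by norm_num : (1 / 2 : ℝ) < 1)
  exact ⟨i, hi.le⟩

open Classical in
/-- The integer `i` with `2^(-i) ≤ t < 2^(1-i)`. -/
noncomputable def scale (z : region n) : ℕ := Nat.find (exists_pow_le z)

theorem pow_scale_le (z : region n) : (1 / 2 : ℝ) ^ scale z ≤ z.1.2 := by
  classical
  exact Nat.find_spec (exists_pow_le z)

theorem lt_pow_scale (z : region n) : z.1.2 < 2 * (1 / 2) ^ scale z := by
  classical
  rcases h : scale z with _ | i
  -- Generation 0 has no predecessor, but `t < m(y) ≤ 1`.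
  · linarith [z.2.2, adm_le_one z.1.1, pow_zero (1 / 2 : ℝ)]
  · have h1 : ¬ (1 / 2 : ℝ) ^ i ≤ z.1.2 :=
      Nat.find_min (exists_pow_le z) (by change i < scale z; omega)
    rw [pow_succ]
    linarith [not_le.1 h1]

theorem measurable_scale : Measurable (scale (n := n)) := by
  classical
  exact measurable_find exists_pow_le fun i =>
    measurableSet_le measurable_const (measurable_snd.comp measurable_subtype_coe)

variable {κ : ℕ} {δ : ℝ}

theorem dist_le_mul_pow {j : ℕ} (hκ : √n * (1 / 2) ^ κ ≤ δ) {x y : EuclideanSpace ℝ (Fin n)}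
    (h : dyadicIndex (j + κ) x = dyadicIndex (j + κ) y) : dist x y ≤ δ * (1 / 2) ^ j := by
  refine (dist_le_of_dyadicIndex_eq h).trans ?_
  rw [add_comm, pow_add, ← mul_assoc]
  gcongr

/-- The shift `κ` makes the diameter of the cube at most `δ 2^(-i) < 2^(-i) ≤ t`. -/
theorem mem_ball_of_dyadicIndex_eq (hκ : √n * (1 / 2) ^ κ ≤ δ) (hδ : δ < 1) {z : region n}
    {x : EuclideanSpace ℝ (Fin n)}
    (h : dyadicIndex (scale z + κ) x = dyadicIndex (scale z + κ) z.1.1) :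
    x ∈ Metric.ball z.1.1 z.1.2 := by
  refine (dist_le_mul_pow hκ h).trans_lt ?_
  have h1 := pow_scale_le z
  have h2 : (0 : ℝ) < (1 / 2) ^ scale z := by positivity
  nlinarith

/-- The ball has radius at most `3 · 2^(-i) ≤ 3t ≤ 3 m(y)`, and the cube lies within `t` of `y`, so
`gaussian_ball_le` applies. The factor `3 · 2^(κ+1)` is the ratio of `3 · 2^(-i)` to the radius of
the ball inside the cube. -/
theorem gaussian_ball_le_dyadic (hκ : √n * (1 / 2) ^ κ ≤ δ) (hδ : δ < 1) (z : region n) {r : ℝ}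
    (hr : r ≤ 3 * (1 / 2) ^ scale z) :
    gaussian n (Metric.ball z.1.1 r) ≤
      ENNReal.ofReal (Real.exp 15 * (3 * 2 ^ (κ + 1)) ^ n) *
        gaussian n (dyadicIndex (scale z + κ) ⁻¹' {dyadicIndex (scale z + κ) z.1.1}) := by
  obtain ⟨p, hp⟩ := exists_ball_subset_dyadic (scale z + κ) (dyadicIndex (scale z + κ) z.1.1)
  have h1 := pow_scale_le z
  have h2 := z.2.2
  have h3 := z.2.1
  refine (gaussian_ball_le (p := p) (ρ := (1 / 2) ^ (scale z + κ + 1)) (a := 3 * 2 ^ (κ + 1))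
    (by linarith) (by positivity) ?_ ?_).trans ?_
  · intro x hx
    have := mem_ball_of_dyadicIndex_eq hκ hδ (hp hx)
    exact (Metric.mem_ball.1 this).le.trans (by linarith)
  · refine hr.trans_eq ?_
    have h4 : (2 : ℝ) ^ (κ + 1) * (1 / 2) ^ (κ + 1) = 1 := by rw [← mul_pow]; norm_num
    rw [add_assoc, pow_add]
    linear_combination -(3 * (1 / 2) ^ scale z) * h4
  · gcongr

/-- It suffices to bound `t_z + |y_z - y_w|` by the radius. It is at most `2 · 2^(-j) + δ 2^(-j)`,
with `j` the scale of `w`, and also at most `m(y_z) + δ m(y_w) ≤ (1 + 3δ) m(y_w) ≤ α m(y_w)`. The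
second bound is where `α > 1` leaves room for `δ`. -/
theorem mem_tent_of_dyadicIndex_eq {α : ℝ} (hκ : √n * (1 / 2) ^ κ ≤ δ) (hδ : δ ≤ 1 / 2)
    (hδα : 3 * δ ≤ α - 1) {z w : region n} (hzw : scale w ≤ scale z)
    (h : dyadicIndex (scale w + κ) z.1.1 = dyadicIndex (scale w + κ) w.1.1) :
    z.1 ∈ tent 1 (Metric.ball w.1.1 (min (3 * (1 / 2) ^ scale w) (α * adm w.1.1))) := by
  have hδ0 : 0 ≤ δ := le_trans (by positivity) hκ
  have hd := dist_le_mul_pow hκ h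
  have hw := pow_scale_le w
  have hw2 := w.2.2
  have hpos : (0 : ℝ) < (1 / 2) ^ scale w := by positivity
  have hd2 : dist z.1.1 w.1.1 ≤ δ * adm w.1.1 := hd.trans (by gcongr; linarith)
  have hz := lt_pow_scale z
  have hpow : (1 / 2 : ℝ) ^ scale z ≤ (1 / 2) ^ scale w :=
    pow_le_pow_of_le_one (by norm_num) (by norm_num) hzw
  have ha := adm_mul_le hd2
  have haw := adm_pos w.1.1
  have haz := adm_pos z.1.1
  have hzr : z.1.2 + dist z.1.1 w.1.1 ≤ min (3 * (1 / 2) ^ scale w) (α * adm w.1.1) := by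
    refine le_min (by nlinarith) ?_
    -- `(1 - δ)(1 + 2δ) = 1 + δ(1 - 2δ) ≥ 1` because `δ ≤ 1/2`.
    have h1 : adm z.1.1 ≤ adm z.1.1 * (1 - δ) * (1 + 2 * δ) := by
      have : 0 ≤ δ * (1 - 2 * δ) := mul_nonneg hδ0 (by linarith)
      nlinarith
    have h2 : adm z.1.1 * (1 - δ) * (1 + 2 * δ) ≤ adm w.1.1 * (1 + 2 * δ) := by gcongr
    have := z.2.2
    nlinarith
  refine ⟨z.2.1, Metric.le_infEDist.2 fun x hx => ?_⟩
  rw [one_mul, edist_dist]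
  refine ENNReal.ofReal_le_ofReal ?_
  have h1 : min (3 * (1 / 2) ^ scale w) (α * adm w.1.1) ≤ dist x w.1.1 := not_lt.1 hx
  have h2 := dist_triangle x z.1.1 w.1.1
  rw [dist_comm x z.1.1] at h2
  linarith

end GaussianTent

namespace GaussianTent

/-! ### Stopping times for nested countable partitions. -/

section Stopping

variable {X V : Type*} [MeasurableSpace X] (γ : Measure X) (p : ℕ → X → V)
  (s : ℕ → V → ℝ≥0∞)

/-- The contribution of the cell of generation `i` around `x` to the discrete square function. -/
noncomputable def cellDensity (i : ℕ) (x : X) : ℝ≥0∞ := s i (p i x) / γ (p i ⁻¹' {p i x})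

/-- The discrete square function, truncated to the generations up to `i`. -/
noncomputable def partialSquare (i : ℕ) (x : X) : ℝ≥0∞ :=
  ∑ j ∈ Finset.range (i + 1), cellDensity γ p s j x

/-- The points whose partial square function exceeds `M` for the first time in generation `j`. -/
def stopSet (M : ℝ≥0∞) (j : ℕ) : Set X :=
  {x | M < partialSquare γ p s j x ∧ ∀ i < j, partialSquare γ p s i x ≤ M}

variable {γ p s}

theorem partialSquare_mono (x : X) : Monotone fun i => partialSquare γ p s i x := fun i j hij =>
  Finset.sum_le_sum_of_subset (Finset.range_subset_range.2 (by omega))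

theorem partialSquare_le_tsum (i : ℕ) (x : X) :
    partialSquare γ p s i x ≤ ∑' j, cellDensity γ p s j x :=
  ENNReal.sum_le_tsum _

/-- Only generations up to `i` enter, and their cells are determined by the cell of generation `j ≥
i`. This is why the square function is truncated. -/
theorem partialSquare_congr (hp : ∀ i j, i ≤ j → ∀ x y, p j x = p j y → p i x = p i y)
    {j : ℕ} {x y : X} (h : p j x = p j y) {i : ℕ} (hij : i ≤ j) :
    partialSquare γ p s i x = partialSquare γ p s i y := by
  refine Finset.sum_congr rfl fun k hk => ?_
  have hk' : p k x = p k y := hp k j (by rw [Finset.mem_range] at hk; omega) x y h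
  rw [cellDensity, cellDensity, hk']

theorem stopSet_congr (hp : ∀ i j, i ≤ j → ∀ x y, p j x = p j y → p i x = p i y)
    {M : ℝ≥0∞} {j : ℕ} {x y : X} (h : p j x = p j y) :
    x ∈ stopSet γ p s M j ↔ y ∈ stopSet γ p s M j := by
  simp only [stopSet, mem_ofPred_eq, partialSquare_congr hp h le_rfl]
  refine and_congr_right fun _ => forall_congr' fun i => imp_congr_right fun hi => ?_
  rw [partialSquare_congr hp h hi.le]

theorem stopSet_unique {M : ℝ≥0∞} {i j : ℕ} {x : X} (hi : x ∈ stopSet γ p s M i)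
    (hj : x ∈ stopSet γ p s M j) : i = j := by
  rcases lt_trichotomy i j with h | h | h
  · exact absurd (hj.2 i h) hi.1.not_ge
  · exact h
  · exact absurd (hi.2 j h) hj.1.not_ge

theorem exists_mem_stopSet {M : ℝ≥0∞} {i : ℕ} {x : X} (h : M < partialSquare γ p s i x) :
    ∃ j ≤ i, x ∈ stopSet γ p s M j := by
  classical
  have hex : ∃ j, M < partialSquare γ p s j x := ⟨i, h⟩
  exact ⟨Nat.find hex, Nat.find_min' hex h, Nat.find_spec hex,
    fun k hk => not_lt.1 (Nat.find_min hex hk)⟩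

/-- Otherwise the partial sum would have exceeded `M` one generation earlier. In the application,
this puts a point of `D` of the right scale above each stopping cube. -/
theorem cellDensity_ne_zero_of_mem_stopSet {M : ℝ≥0∞} {j : ℕ} {x : X}
    (h : x ∈ stopSet γ p s M j) : cellDensity γ p s j x ≠ 0 := by
  intro h0
  have h1 := h.1
  rcases j with _ | j
  · simp [partialSquare, h0] at h1
  · rw [partialSquare, Finset.sum_range_succ, h0, add_zero] at h1
    exact (h.2 j (Nat.lt_succ_self j)).not_gt h1

-- Partial sums increase, so the terms kept form an initial segment, whose sum is itself a partial
-- sum bounded by `M`.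
open Classical in
theorem tsum_cellDensity_le (M : ℝ≥0∞) (x : X) :
    ∑' i, (if partialSquare γ p s i x ≤ M then cellDensity γ p s i x else 0) ≤ M := by
  refine ENNReal.tsum_le_of_sum_range_le fun N => ?_
  induction N with
  | zero => simp
  | succ N ih =>
    by_cases h : partialSquare γ p s N x ≤ M
    · refine le_trans (Finset.sum_le_sum fun i _ => ?_) h
      split_ifs <;> simp
    · rw [Finset.sum_range_succ, if_neg h, add_zero]
      exact ih

variable [MeasurableSpace V] [Countable V] [MeasurableSingletonClass V]

theorem measurable_of_cell (hpm : ∀ i, Measurable (p i)) {j : ℕ} {A : Set X}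
    (hA : ∀ x y, p j x = p j y → x ∈ A → y ∈ A) : MeasurableSet A := by
  have : A = p j ⁻¹' (p j '' A) := by
    refine Subset.antisymm (subset_preimage_image _ _) ?_
    rintro y ⟨x, hx, hxy⟩
    exact hA x y hxy hx
  rw [this]
  exact hpm j (to_countable _).measurableSet

theorem measurableSet_stopSet (hpm : ∀ i, Measurable (p i))
    (hp : ∀ i j, i ≤ j → ∀ x y, p j x = p j y → p i x = p i y) (M : ℝ≥0∞) (j : ℕ) :
    MeasurableSet (stopSet γ p s M j) :=
  measurable_of_cell hpm (j := j) fun _ _ h => (stopSet_congr hp h).1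

/-- A point stops at most once, so the stopping cells are disjoint; all lie where the full sum
exceeds `M`. -/
theorem tsum_measure_stopSet_le (hpm : ∀ i, Measurable (p i))
    (hp : ∀ i j, i ≤ j → ∀ x y, p j x = p j y → p i x = p i y) (M : ℝ≥0∞) :
    ∑' τ : ℕ × V, γ (p τ.1 ⁻¹' {τ.2} ∩ stopSet γ p s M τ.1) ≤
      γ {x | M < ∑' i, cellDensity γ p s i x} := by
  rw [← measure_iUnion]
  · refine measure_mono (iUnion_subset fun τ x hx => ?_)
    exact hx.2.1.trans_le (partialSquare_le_tsum _ _)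
  · intro τ τ' hne
    refine disjoint_left.2 fun x hx hx' => hne ?_
    have h1 : τ.1 = τ'.1 := stopSet_unique hx.2 hx'.2
    refine Prod.ext h1 ?_
    have h2 : p τ.1 x = τ.2 := hx.1
    have h3 : p τ'.1 x = τ'.2 := hx'.1
    rw [← h2, ← h3, h1]
  · intro τ
    exact (hpm _ (measurableSet_singleton _)).inter (measurableSet_stopSet hpm hp _ _)

/-- The mass of a family of cells over `G` on which the partial square function is at most `M`. -/
theorem tsum_indicator_cell_le [IsFiniteMeasure γ] (hpm : ∀ i, Measurable (p i))
    (hs : ∀ i v, s i v ≠ 0 → γ (p i ⁻¹' {v}) ≠ 0) {F : Set (ℕ × V)} {G : Set X}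
    (hG : MeasurableSet G) {M : ℝ≥0∞}
    (hF : ∀ i x, (i, p i x) ∈ F → x ∈ G ∧ partialSquare γ p s i x ≤ M) :
    ∑' τ : ℕ × V, F.indicator (fun τ => s τ.1 τ.2) τ ≤ M * γ G := by
  have hcell (τ : ℕ × V) : MeasurableSet (p τ.1 ⁻¹' {τ.2}) := hpm _ (measurableSet_singleton _)
  -- Each mass is the integral of its density over its cell, so the sum over cells can be moved
  -- under the integral and bounded pointwise.
  have h1 (τ : ℕ × V) : F.indicator (fun τ => s τ.1 τ.2) τ =
      ∫⁻ x, (p τ.1 ⁻¹' {τ.2}).indicator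
        (fun _ => F.indicator (fun τ => s τ.1 τ.2 / γ (p τ.1 ⁻¹' {τ.2})) τ) x ∂γ := by
    rw [lintegral_indicator_const (hcell τ)]
    by_cases hτ : τ ∈ F
    · rw [indicator_of_mem hτ, indicator_of_mem hτ]
      by_cases h0 : s τ.1 τ.2 = 0
      · simp [h0]
      · rw [ENNReal.div_mul_cancel (hs _ _ h0) (measure_ne_top _ _)]
    · simp [hτ]
  simp_rw [h1]
  rw [← lintegral_tsum fun τ => (measurable_const.indicator (hcell τ)).aemeasurable,
    ← lintegral_indicator_const hG]
  refine lintegral_mono fun x => ?_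
  rw [ENNReal.tsum_prod']
  have h2 (i : ℕ) : ∑' v, (p i ⁻¹' {v}).indicator
      (fun _ => F.indicator (fun τ : ℕ × V => s τ.1 τ.2 / γ (p τ.1 ⁻¹' {τ.2})) (i, v)) x =
      F.indicator (fun τ : ℕ × V => s τ.1 τ.2 / γ (p τ.1 ⁻¹' {τ.2})) (i, p i x) := by
    rw [tsum_eq_single (p i x)]
    · have : x ∈ p i ⁻¹' {p i x} := rfl
      rw [indicator_of_mem this]
    · intro v hv
      exact indicator_of_notMem (fun h => hv h.symm) _
  simp only [h2]
  by_cases hx : x ∈ G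
  · rw [indicator_of_mem hx]
    refine le_trans (ENNReal.tsum_le_tsum fun i => ?_)
      (tsum_cellDensity_le (γ := γ) (p := p) (s := s) M x)
    by_cases hi : (i, p i x) ∈ F
    · rw [indicator_of_mem hi, if_pos (hF i x hi).2]
      rfl
    · rw [indicator_of_notMem hi]
      exact zero_le
  · have h3 (i : ℕ) : (i, p i x) ∉ F := fun h => hx (hF i x h).1
    simp [h3]

end Stopping

/-! ### Summation over dyadic levels. -/

theorem two_zpow_eq_ofReal (k : ℤ) : (2 : ℝ≥0∞) ^ k = ENNReal.ofReal (2 ^ k) := by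
  have h : (2 : ℝ) ^ k = ((2 : NNReal) ^ k : NNReal) := by push_cast; rfl
  rw [h, ENNReal.ofReal_coe_nnreal, ENNReal.coe_zpow two_ne_zero]
  rfl

/-- `2^(k+1)` is four times the length of `(2^(k-1), 2^k]`; for `2^k < S` these disjoint intervals
lie in `(0, S]`. -/
theorem tsum_two_zpow_le (S : ℝ≥0∞) :
    ∑' k : ℤ, {x : ℝ≥0∞ | (2 : ℝ≥0∞) ^ k < x}.indicator (fun _ => (2 : ℝ≥0∞) ^ (k + 1)) S ≤
      4 * S := by
  rcases eq_or_ne S ∞ with rfl | hS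
  · simp
  have hmono : Monotone fun k : ℤ => (2 : ℝ) ^ k := zpow_right_mono₀ one_le_two
  have h1 (k : ℤ) : {x : ℝ≥0∞ | (2 : ℝ≥0∞) ^ k < x}.indicator (fun _ => (2 : ℝ≥0∞) ^ (k + 1)) S ≤
      4 * volume (Ioc ((2 : ℝ) ^ (k - 1)) (2 ^ k) ∩ Ioc 0 S.toReal) := by
    by_cases hk : (2 : ℝ≥0∞) ^ k < S
    · have hk' : (2 : ℝ) ^ k < S.toReal := by
        rwa [two_zpow_eq_ofReal, ENNReal.ofReal_lt_iff_lt_toReal (by positivity) hS] at hk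
      have h0 : (0 : ℝ) < 2 ^ (k - 1) := by positivity
      rw [indicator_of_mem (by exact hk), Ioc_inter_Ioc, sup_eq_left.2 h0.le,
        inf_eq_left.2 hk'.le, Real.volume_Ioc]
      have h4 : (4 : ℝ≥0∞) = ENNReal.ofReal 4 := by simp
      rw [h4, ← ENNReal.ofReal_mul (by norm_num), two_zpow_eq_ofReal, zpow_add_one₀ (by norm_num),
        zpow_sub_one₀ (by norm_num)]
      refine ENNReal.ofReal_le_ofReal (le_of_eq ?_)
      ring
    · rw [indicator_of_notMem (by exact hk)]
      exact zero_le
  refine (ENNReal.tsum_le_tsum h1).trans ?_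
  rw [ENNReal.tsum_mul_left, ← measure_iUnion]
  · gcongr
    refine (measure_mono (iUnion_subset fun k => inter_subset_right)).trans ?_
    rw [Real.volume_Ioc, sub_zero, ENNReal.ofReal_toReal hS]
  · intro k l hkl
    exact (hmono.pairwise_disjoint_on_Ioc_pred hkl).mono inter_subset_left inter_subset_left
  · exact fun k => measurableSet_Ioc.inter measurableSet_Ioc

theorem lintegral_two_zpow_le {X : Type*} [MeasurableSpace X] (γ : Measure X) {S : X → ℝ≥0∞}
    (hS : Measurable S) :
    ∑' k : ℤ, (2 : ℝ≥0∞) ^ (k + 1) * γ {x | (2 : ℝ≥0∞) ^ k < S x} ≤ 4 * ∫⁻ x, S x ∂γ := by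
  have hm (k : ℤ) : MeasurableSet {x | (2 : ℝ≥0∞) ^ k < S x} :=
    measurableSet_lt measurable_const hS
  simp_rw [← lintegral_indicator_const (hm _)]
  rw [← lintegral_tsum fun k => (measurable_const.indicator (hm k)).aemeasurable,
    ← lintegral_const_mul _ hS]
  exact lintegral_mono fun x => tsum_two_zpow_le (S x)

end GaussianTent

namespace GaussianTent

/-! ### The square function of `f` and its stopping regions. -/

variable {n : ℕ} {q δ α : ℝ} {κ : ℕ}

/-- The dyadic cube, of side comparable to `t`, attached to the point `(y, t)`: its generation and
its index. -/
noncomputable def tag (κ : ℕ) (z : region n) : ℕ × (Fin n → ℤ) :=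
  (scale z, dyadicIndex (scale z + κ) z.1.1)

theorem tag_eq_iff {z : region n} {τ : ℕ × (Fin n → ℤ)} :
    tag κ z = τ ↔ scale z = τ.1 ∧ dyadicIndex (τ.1 + κ) z.1.1 = τ.2 := by
  unfold tag
  constructor
  · rintro rfl; exact ⟨rfl, rfl⟩
  · rintro ⟨h1, h2⟩
    exact Prod.ext h1 (by rw [← h2, ← h1])

theorem measurable_tag : Measurable (tag (n := n) κ) := by
  refine measurable_to_countable' fun τ => ?_
  have : tag (n := n) κ ⁻¹' {τ} =
      scale ⁻¹' {τ.1} ∩ (fun z : region n => dyadicIndex (τ.1 + κ) z.1.1) ⁻¹' {τ.2} := by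
    ext z
    exact tag_eq_iff
  rw [this]
  refine (measurable_scale (measurableSet_singleton _)).inter ?_
  exact ((measurable_dyadicIndex _).comp (measurable_fst.comp measurable_subtype_coe))
    (measurableSet_singleton _)

/-- The measure `|f|^q dγ dt/t`. -/
noncomputable def massMeasure (q : ℝ) (f : region n → ℂ) : Measure (region n) :=
  (regionMeasure n).withDensity fun z => ‖f z‖ₑ ^ q

/-- The mass of `|f|^q` on the points attached to a dyadic cube. -/
noncomputable def cellMass (κ : ℕ) (q : ℝ) (f : region n → ℂ) (i : ℕ) (v : Fin n → ℤ) : ℝ≥0∞ :=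
  massMeasure q f (tag κ ⁻¹' {(i, v)})

/-- The stopping set, for the discrete square function of `f` at height `2^k`. -/
def stopCells (κ : ℕ) (q : ℝ) (f : region n → ℂ) (k : ℤ) (j : ℕ) :
    Set (EuclideanSpace ℝ (Fin n)) :=
  stopSet (gaussian n) (fun i => dyadicIndex (i + κ)) (cellMass κ q f) (((2 : ℝ≥0∞) ^ k) ^ q) j

/-- The discrete square function of `f`, to the power `q`, truncated to generations up to `i`. -/
noncomputable def square (κ : ℕ) (q : ℝ) (f : region n → ℂ) (i : ℕ)
    (x : EuclideanSpace ℝ (Fin n)) : ℝ≥0∞ :=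
  partialSquare (gaussian n) (fun i => dyadicIndex (i + κ)) (cellMass κ q f) i x

/-- The part of `D` on which an atom lives: the points above the stopping cube `v` of
generation `j` at which the discrete square function is comparable to `2^k`. -/
def stopRegion (κ : ℕ) (q : ℝ) (f : region n → ℂ) (θ : ℤ × ℕ × (Fin n → ℤ)) : Set (region n) :=
  {z | dyadicIndex (θ.2.1 + κ) z.1.1 = θ.2.2 ∧ θ.2.1 ≤ scale z ∧ z.1.1 ∈ stopCells κ q f θ.1 θ.2.1 ∧
    square κ q f (scale z) z.1.1 ≤ ((2 : ℝ≥0∞) ^ (θ.1 + 1)) ^ q}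

theorem dyadicIndex_nested (κ : ℕ) (i j : ℕ) (hij : i ≤ j) (x y : EuclideanSpace ℝ (Fin n))
    (h : dyadicIndex (j + κ) x = dyadicIndex (j + κ) y) :
    dyadicIndex (i + κ) x = dyadicIndex (i + κ) y :=
  dyadicIndex_eq_of_le (by omega) h

theorem gaussian_dyadic_ne_zero (j : ℕ) (v : Fin n → ℤ) :
    gaussian n (dyadicIndex j ⁻¹' {v}) ≠ 0 := by
  obtain ⟨p, hp⟩ := exists_ball_subset_dyadic j v
  exact ((Metric.isOpen_ball.measure_pos (gaussian n)
    (Metric.nonempty_ball.2 (by positivity))).trans_le (measure_mono hp)).ne'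

/-- Each region is thus a union of tag fibres, which gives its measurability and lets its mass be
summed cube by cube. -/
theorem mem_stopRegion_congr {f : region n → ℂ} {θ : ℤ × ℕ × (Fin n → ℤ)} {z w : region n}
    (h : tag κ z = tag κ w) (hz : z ∈ stopRegion κ q f θ) : w ∈ stopRegion κ q f θ := by
  obtain ⟨h1, h2, h3, h4⟩ := hz
  obtain ⟨h5, h6⟩ := tag_eq_iff.1 h
  have h6' : dyadicIndex (scale w + κ) z.1.1 = dyadicIndex (scale w + κ) w.1.1 := h6
  have h5' : scale z = scale w := h5
  have h7 := dyadicIndex_nested κ θ.2.1 (scale w) (h5' ▸ h2) _ _ h6'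
  refine ⟨h7 ▸ h1, h5' ▸ h2, (stopSet_congr (dyadicIndex_nested κ) h7).1 h3, ?_⟩
  rw [← h5', square, ← partialSquare_congr (dyadicIndex_nested κ) (j := scale w) h6' h5'.le]
  exact h4

theorem tag_preimage_image_stopRegion (f : region n → ℂ) (θ : ℤ × ℕ × (Fin n → ℤ)) :
    tag κ ⁻¹' (tag κ '' stopRegion κ q f θ) = stopRegion κ q f θ := by
  refine Subset.antisymm ?_ (subset_preimage_image _ _)
  rintro w ⟨z, hz, hzw⟩
  exact mem_stopRegion_congr hzw hz

theorem measurableSet_stopRegion (f : region n → ℂ) (θ : ℤ × ℕ × (Fin n → ℤ)) :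
    MeasurableSet (stopRegion κ q f θ) := by
  rw [← tag_preimage_image_stopRegion]
  exact measurable_tag (to_countable _).measurableSet

theorem massMeasure_stopRegion_le (f : region n → ℂ) (θ : ℤ × ℕ × (Fin n → ℤ)) :
    massMeasure q f (stopRegion κ q f θ) ≤ ((2 : ℝ≥0∞) ^ (θ.1 + 1)) ^ q *
      gaussian n (dyadicIndex (θ.2.1 + κ) ⁻¹' {θ.2.2} ∩ stopCells κ q f θ.1 θ.2.1) := by
  have hF : MeasurableSet (tag κ '' stopRegion κ q f θ) := (to_countable _).measurableSet
  rw [← tag_preimage_image_stopRegion, ← Measure.map_apply measurable_tag hF,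
    ← Measure.tsum_indicator_apply_singleton _ _ hF]
  simp_rw [Measure.map_apply measurable_tag (measurableSet_singleton _)]
  refine tsum_indicator_cell_le (p := fun i => dyadicIndex (i + κ)) (s := cellMass κ q f)
    (fun i => measurable_dyadicIndex _) (fun i v _ => gaussian_dyadic_ne_zero _ _) ?_ ?_
  · exact ((measurable_dyadicIndex _) (measurableSet_singleton _)).inter
      (measurableSet_stopSet (fun i => measurable_dyadicIndex _) (dyadicIndex_nested κ) _ _)
  · rintro i x ⟨z, ⟨h1, h2, h3, h4⟩, hzx⟩
    obtain ⟨h5, h6⟩ := tag_eq_iff.1 hzx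
    have h5' : scale z = i := h5
    subst h5'
    have h7 := dyadicIndex_nested κ _ _ h2 _ _ h6
    refine ⟨⟨h7.symm.trans h1, (stopSet_congr (dyadicIndex_nested κ) h7).1 h3⟩, ?_⟩
    exact (partialSquare_congr (dyadicIndex_nested κ) h6 le_rfl).symm.trans_le h4

/-- At a common point, `2^(kq)` is less than the partial sum, which is at most `2^((k'+1)q)`, so `k
≤ k'`; by symmetry `k = k'`. The stopping generation and the cube are then determined. -/
theorem pairwise_disjoint_stopRegion (hq : 1 < q) (f : region n → ℂ) :
    Pairwise (Function.onFun Disjoint (stopRegion κ q f)) := by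
  have hq0 : 0 < q := by linarith
  have key : ∀ θ θ' : ℤ × ℕ × (Fin n → ℤ), ∀ z, z ∈ stopRegion κ q f θ →
      z ∈ stopRegion κ q f θ' → θ.1 ≤ θ'.1 := by
    intro θ θ' z hz hz'
    have h1 : ((2 : ℝ≥0∞) ^ θ.1) ^ q < ((2 : ℝ≥0∞) ^ (θ'.1 + 1)) ^ q :=
      (hz.2.2.1.1.trans_le (partialSquare_mono _ hz.2.1)).trans_le hz'.2.2.2
    rw [ENNReal.rpow_lt_rpow_iff hq0, two_zpow_eq_ofReal, two_zpow_eq_ofReal,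
      ENNReal.ofReal_lt_ofReal_iff (by positivity), zpow_lt_zpow_iff_right₀ one_lt_two] at h1
    omega
  intro θ θ' hne
  refine disjoint_left.2 fun z hz hz' => hne ?_
  have h1 : θ.1 = θ'.1 := le_antisymm (key _ _ z hz hz') (key _ _ z hz' hz)
  have h2 : θ.2.1 = θ'.2.1 := by
    have h3 := hz.2.2.1
    rw [h1] at h3
    exact stopSet_unique h3 hz'.2.2.1
  refine Prod.ext h1 (Prod.ext h2 ?_)
  rw [← hz.1, ← hz'.1, h2]

theorem massMeasure_univ (hq : 1 < q) (f : region n → ℂ) :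
    massMeasure q f univ = eLpNorm f (ENNReal.ofReal q) (regionMeasure n) ^ q := by
  have hq0 : 0 < q := by linarith
  rw [eLpNorm_eq_lintegral_rpow_enorm_toReal (ENNReal.ofReal_pos.2 hq0).ne' ENNReal.ofReal_ne_top,
    ENNReal.toReal_ofReal hq0.le, one_div, ENNReal.rpow_inv_rpow hq0.ne', massMeasure,
    withDensity_apply _ MeasurableSet.univ, setLIntegral_univ]

theorem eLpNorm_indicator_eq_massMeasure (hq : 1 < q) (f : region n → ℂ) {E : Set (region n)}
    (hE : MeasurableSet E) :
    eLpNorm (E.indicator f) (ENNReal.ofReal q) (regionMeasure n) = massMeasure q f E ^ (1 / q) := by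
  have hq0 : 0 < q := by linarith
  rw [eLpNorm_indicator_eq_eLpNorm_restrict hE,
    eLpNorm_eq_lintegral_rpow_enorm_toReal (ENNReal.ofReal_pos.2 hq0).ne' ENNReal.ofReal_ne_top,
    ENNReal.toReal_ofReal hq0.le, massMeasure, withDensity_apply _ hE]

/-- The countably many fibres without mass are negligible. At any other point the partial sum is
positive and finite, hence in `(2^(kq), 2^((k+1)q)]` for some `k`, and stopping at level `k` has
already occurred. -/
theorem massMeasure_compl_iUnion_stopRegion (hq : 1 < q) {f : region n → ℂ}
    (hf : massMeasure q f univ ≠ ∞) :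
    massMeasure q f (⋃ θ, stopRegion κ q f θ)ᶜ = 0 := by
  have hq0 : 0 < q := by linarith
  set N : Set (ℕ × (Fin n → ℤ)) := {τ | cellMass κ q f τ.1 τ.2 = 0}
  have hN : massMeasure q f (tag κ ⁻¹' N) = 0 := by
    rw [← biUnion_preimage_singleton, measure_biUnion_null_iff (to_countable _)]
    exact fun τ hτ => hτ
  refine measure_mono_null ?_ hN
  intro z hz
  by_contra hzN
  refine hz (mem_iUnion.2 ?_)
  have hfin (i : ℕ) (v : Fin n → ℤ) : cellMass κ q f i v ≠ ∞ :=
    ((measure_mono (subset_univ _)).trans_lt hf.lt_top).ne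
  have h0 : square κ q f (scale z) z.1.1 ≠ 0 := by
    refine ne_of_gt (lt_of_lt_of_le ?_ (Finset.single_le_sum (fun _ _ => zero_le)
      (Finset.mem_range.2 (Nat.lt_succ_self (scale z)))))
    exact pos_iff_ne_zero.2 (ENNReal.div_ne_zero.2 ⟨hzN, measure_ne_top _ _⟩)
  have h1 : square κ q f (scale z) z.1.1 ≠ ∞ := by
    unfold square partialSquare
    exact ENNReal.sum_ne_top.2 fun i _ =>
      ENNReal.div_ne_top (hfin i (dyadicIndex (i + κ) z.1.1))
        (gaussian_dyadic_ne_zero (i + κ) (dyadicIndex (i + κ) z.1.1))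
  obtain ⟨k, hk1, hk2⟩ := ENNReal.exists_mem_Ioc_zpow
    (x := square κ q f (scale z) z.1.1 ^ (1 / q)) (y := 2)
    (by simp [h0, h1]) (by simp [h0, h1]) (by norm_num) (by norm_num)
  rw [one_div, ENNReal.lt_rpow_inv_iff hq0] at hk1
  rw [one_div, ENNReal.rpow_inv_le_iff hq0] at hk2
  obtain ⟨j, hj, hjs⟩ := exists_mem_stopSet hk1
  exact ⟨(k, j, dyadicIndex (j + κ) z.1.1), rfl, hj, hjs, hk2⟩

/-- The constant that compares a ball with the dyadic cube inside it. -/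
noncomputable def compConst (n κ : ℕ) : ℝ≥0∞ :=
  ENNReal.ofReal (Real.exp 15 * (3 * 2 ^ (κ + 1)) ^ n)

theorem one_le_compConst (n κ : ℕ) : 1 ≤ compConst n κ := by
  refine ENNReal.one_le_ofReal.2 (one_le_mul_of_one_le_of_one_le (Real.one_le_exp (by norm_num)) ?_)
  refine one_le_pow₀ ?_
  have : (1 : ℝ) ≤ 2 ^ (κ + 1) := one_le_pow₀ one_le_two
  linarith

/-- If `z = (y, t)` is tagged by a cube containing `x`, then `x ∈ B(y, t)` and `γ(B(y, t))` is at
most a constant times the measure of the cube. The fibres for distinct generations are disjoint. -/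
theorem tsum_cellDensity_le_tentJ (hq : 1 < q) (hκ : √n * (1 / 2) ^ κ ≤ δ) (hδ : δ < 1)
    (f : region n → ℂ) (x : EuclideanSpace ℝ (Fin n)) :
    ∑' i, cellDensity (gaussian n) (fun i => dyadicIndex (i + κ)) (cellMass κ q f) i x ≤
      compConst n κ * eLpNorm (tentJ q f x) (ENNReal.ofReal q) (regionMeasure n) ^ q := by
  have hq0 : 0 < q := by linarith
  set A : ℕ → Set (region n) := fun i => tag κ ⁻¹' {(i, dyadicIndex (i + κ) x)} with hA
  have hAm (i : ℕ) : MeasurableSet (A i) := measurable_tag (measurableSet_singleton _)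
  set h : region n → ℝ≥0∞ := fun z => (Metric.ball z.1.1 z.1.2).indicator
    (fun _ => (gaussian n (Metric.ball z.1.1 z.1.2))⁻¹ * ‖f z‖ₑ ^ q) x with hh
  have hC : compConst n κ ≠ ∞ := ENNReal.ofReal_ne_top
  have hle (i : ℕ) :
      cellDensity (gaussian n) (fun i => dyadicIndex (i + κ)) (cellMass κ q f) i x ≤
        ∫⁻ z in A i, compConst n κ * h z ∂(regionMeasure n) := by
    rw [cellDensity, cellMass, massMeasure, withDensity_apply _ (hAm i), div_eq_mul_inv,
      ← lintegral_mul_const' _ _ (ENNReal.inv_ne_top.2 (gaussian_dyadic_ne_zero _ _))]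
    refine setLIntegral_mono' (hAm i) fun z hz => ?_
    obtain ⟨h1, h2⟩ := tag_eq_iff.1 hz
    have h1' : scale z = i := h1
    subst h1'
    have h2' : dyadicIndex (scale z + κ) z.1.1 = dyadicIndex (scale z + κ) x := h2
    have hz : h z = (gaussian n (Metric.ball z.1.1 z.1.2))⁻¹ * ‖f z‖ₑ ^ q :=
      indicator_of_mem (mem_ball_of_dyadicIndex_eq hκ hδ h2'.symm) _
    rw [hz, ← mul_assoc, mul_comm]
    gcongr
    have h3 := gaussian_ball_le_dyadic hκ hδ z (r := z.1.2)
      (by have := lt_pow_scale z; have : (0 : ℝ) < (1 / 2) ^ scale z := by positivity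
          linarith)
    rw [h2'] at h3
    rw [← div_eq_mul_inv, ENNReal.le_div_iff_mul_le (Or.inl (gaussian_ball_pos z).ne')
      (Or.inl (measure_ne_top _ _)), ← ENNReal.div_eq_inv_mul]
    exact ENNReal.div_le_of_le_mul h3
  rw [eLpNorm_tentJ hq, one_div, ENNReal.rpow_inv_rpow hq0.ne', ← lintegral_const_mul' _ _ hC]
  refine (ENNReal.tsum_le_tsum hle).trans ?_
  rw [← lintegral_iUnion hAm]
  · exact setLIntegral_le_lintegral _ _
  · intro i j hij
    refine disjoint_left.2 fun z hi hj => hij ?_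
    exact (tag_eq_iff.1 hi).1.symm.trans (tag_eq_iff.1 hj).1

theorem tsum_stopCells_le (hq : 1 < q) (hκ : √n * (1 / 2) ^ κ ≤ δ) (hδ : δ < 1)
    {f : region n → ℂ} (hf : Measurable f) :
    ∑' θ : ℤ × ℕ × (Fin n → ℤ), (2 : ℝ≥0∞) ^ (θ.1 + 1) *
      gaussian n (dyadicIndex (θ.2.1 + κ) ⁻¹' {θ.2.2} ∩ stopCells κ q f θ.1 θ.2.1) ≤
      4 * (compConst n κ ^ (1 / q) * tentENorm q f) := by
  have hq0 : 0 < q := by linarith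
  set S : EuclideanSpace ℝ (Fin n) → ℝ≥0∞ := fun x =>
    ∑' i, cellDensity (gaussian n) (fun i => dyadicIndex (i + κ)) (cellMass κ q f) i x with hS
  have hSm : Measurable S := by
    refine Measurable.tsum fun i B _ => measurable_of_cell
      (p := fun i => dyadicIndex (i + κ)) (fun i => measurable_dyadicIndex _) (j := i)
      fun x y h hx => ?_
    rw [mem_preimage, cellDensity] at hx ⊢
    rwa [← h]
  have hSle (x) : S x ^ (1 / q) ≤ compConst n κ ^ (1 / q) *
      eLpNorm (tentJ q f x) (ENNReal.ofReal q) (regionMeasure n) := by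
    refine (ENNReal.rpow_le_rpow (tsum_cellDensity_le_tentJ hq hκ hδ f x)
      (by positivity)).trans_eq ?_
    rw [ENNReal.mul_rpow_of_nonneg _ _ (by positivity), one_div, ENNReal.rpow_rpow_inv hq0.ne']
  have h1 (k : ℤ) : ∑' τ : ℕ × (Fin n → ℤ), (2 : ℝ≥0∞) ^ (k + 1) *
      gaussian n (dyadicIndex (τ.1 + κ) ⁻¹' {τ.2} ∩ stopCells κ q f k τ.1) ≤
        (2 : ℝ≥0∞) ^ (k + 1) * gaussian n {x | (2 : ℝ≥0∞) ^ k < S x ^ (1 / q)} := by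
    rw [ENNReal.tsum_mul_left]
    gcongr
    refine (tsum_measure_stopSet_le (p := fun i => dyadicIndex (i + κ))
      (fun i => measurable_dyadicIndex _) (dyadicIndex_nested κ) _).trans (measure_mono ?_)
    intro x hx
    rw [mem_ofPred_eq, one_div, ENNReal.lt_rpow_inv_iff hq0]
    exact hx
  rw [ENNReal.tsum_prod']
  refine (ENNReal.tsum_le_tsum h1).trans ((lintegral_two_zpow_le _ (hSm.pow_const _)).trans ?_)
  gcongr
  rw [tentENorm, ← lintegral_const_mul _ (measurable_eLpNorm_tentJ hq hf)]
  exact lintegral_mono hSle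

end GaussianTent

namespace GaussianTent

/-! ### Atoms from stopping regions. -/

variable {n : ℕ} {q δ α : ℝ} {κ : ℕ}

theorem isAtom_zero (hα : 0 ≤ α) : IsAtom q α (0 : region n → ℂ) :=
  ⟨aestronglyMeasurable_zero, 0, 0, le_rfl, mul_nonneg hα (adm_pos _).le, fun _ _ => rfl,
    by simp⟩

/-- The ball of the atom on `stopRegion κ q f θ`. -/
theorem exists_ball_stopRegion (hκ : √n * (1 / 2) ^ κ ≤ δ) (hδ : δ ≤ 1 / 2)
    (hδα : 3 * δ ≤ α - 1) {f : region n → ℂ} {θ : ℤ × ℕ × (Fin n → ℤ)}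
    (hE : (stopRegion κ q f θ).Nonempty) :
    ∃ (c : EuclideanSpace ℝ (Fin n)) (r : ℝ), 0 ≤ r ∧ r ≤ α * adm c ∧
      (∀ z ∈ stopRegion κ q f θ, z.1 ∈ tent 1 (Metric.ball c r)) ∧
      gaussian n (Metric.ball c r) ≤ compConst n κ *
        gaussian n (dyadicIndex (θ.2.1 + κ) ⁻¹' {θ.2.2} ∩ stopCells κ q f θ.1 θ.2.1) := by
  obtain ⟨w, hw1, -, hw3, -⟩ := hE
  have hδ0 : 0 ≤ δ := le_trans (by positivity) hκ
  -- The stopping cube carries mass in its own generation, so it tags some `z₀` in `D`, whose base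
  -- point serves as the centre.
  have h1 : cellMass κ q f θ.2.1 (dyadicIndex (θ.2.1 + κ) w.1.1) ≠ 0 := by
    intro h0
    exact cellDensity_ne_zero_of_mem_stopSet hw3 (by simp [cellDensity, h0])
  obtain ⟨z₀, hz₀⟩ := nonempty_of_measure_ne_zero h1
  obtain ⟨h2, h3⟩ := tag_eq_iff.1 hz₀
  have h2' : scale z₀ = θ.2.1 := h2
  have h3' : dyadicIndex (θ.2.1 + κ) z₀.1.1 = θ.2.2 := h3.trans hw1
  refine ⟨z₀.1.1, min (3 * (1 / 2) ^ scale z₀) (α * adm z₀.1.1), ?_, min_le_right _ _, ?_, ?_⟩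
  · have := adm_pos z₀.1.1
    have : 0 ≤ α := by linarith
    positivity
  · intro z hz
    refine mem_tent_of_dyadicIndex_eq hκ hδ hδα (h2'.trans_le hz.2.1) ?_
    rw [h2', hz.1, h3']
  · refine (gaussian_ball_le_dyadic hκ (by linarith) z₀ (min_le_left _ _)).trans ?_
    -- A cube that meets the stopping set is contained in it, so the intersection is the whole cube.
    refine mul_le_mul_right (measure_mono fun x hx => ?_) _
    rw [h2', h3'] at hx
    refine ⟨hx, (stopSet_congr (dyadicIndex_nested κ) ?_).1 hw3⟩
    exact hw1.trans (Eq.symm hx)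

/-- The coefficient is `C 2^(k+1) g`, with `g` the measure of the stopping cube. The `L^q` norm of
`f` on the region is at most `2^(k+1) g^(1/q)`, and the quotient `(C g^(1/q'))⁻¹` is at most
`γ(B)^(-1/q')`. -/
theorem exists_atom [hq : Fact (1 < q)] (hκ : √n * (1 / 2) ^ κ ≤ δ) (hδ : δ ≤ 1 / 2)
    (hδα : 3 * δ ≤ α - 1) {f : region n → ℂ} (hf : Measurable f)
    (hfL : MemLp f (ENNReal.ofReal q) (regionMeasure n)) (θ : ℤ × ℕ × (Fin n → ℤ)) :
    ∃ (l : ℂ) (a : region n → ℂ) (A : TentSpace n q), Measurable a ∧ IsAtom q α a ∧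
      Represents a A ∧ l • a = (stopRegion κ q f θ).indicator f ∧
      ‖l‖ₑ ≤ compConst n κ * ((2 : ℝ≥0∞) ^ (θ.1 + 1) *
        gaussian n (dyadicIndex (θ.2.1 + κ) ⁻¹' {θ.2.2} ∩ stopCells κ q f θ.1 θ.2.1)) := by
  have hq0 : 0 < q := by linarith [hq.out]
  have hδ0 : 0 ≤ δ := le_trans (by positivity) hκ
  rcases (stopRegion κ q f θ).eq_empty_or_nonempty with hE | hE
  · exact ⟨0, 0, 0, measurable_const, isAtom_zero (by linarith), represents_zero, by simp [hE]; rfl,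
      by simp⟩
  obtain ⟨c, r, hr0, hr, htent, hball⟩ := exists_ball_stopRegion hκ hδ hδα hE
  set g := gaussian n (dyadicIndex (θ.2.1 + κ) ⁻¹' {θ.2.2} ∩ stopCells κ q f θ.1 θ.2.1) with hg
  set C := compConst n κ with hC
  set b : ℝ≥0∞ := (2 : ℝ≥0∞) ^ (θ.1 + 1) with hb
  have hC1 : 1 ≤ C := one_le_compConst n κ
  have hC0 : C ≠ 0 := (zero_lt_one.trans_le hC1).ne'
  have hCt : C ≠ ∞ := ENNReal.ofReal_ne_top
  have hb0 : b ≠ 0 := by rw [hb, two_zpow_eq_ofReal]; exact (ENNReal.ofReal_pos.2 (by positivity)).ne'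
  have hbt : b ≠ ∞ := by rw [hb, two_zpow_eq_ofReal]; exact ENNReal.ofReal_ne_top
  have hgt : g ≠ ∞ := measure_ne_top _ _
  have hg0 : g ≠ 0 := by
    intro h0
    obtain ⟨w, hw⟩ := hE
    have h1 : gaussian n (Metric.ball c r) = 0 := by
      rw [h0, mul_zero] at hball; exact le_antisymm hball zero_le
    have h2 := ball_subset_of_mem_tent (htent w hw)
    exact (gaussian_ball_pos w).ne' (measure_mono_null h2 h1)
  set L : ℝ≥0∞ := C * (b * g) with hL
  have hL0 : L ≠ 0 := mul_ne_zero hC0 (mul_ne_zero hb0 hg0)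
  have hLt : L ≠ ∞ := ENNReal.mul_ne_top hCt (ENNReal.mul_ne_top hbt hgt)
  have hl0 : (L.toReal : ℂ) ≠ 0 := by
    exact_mod_cast (ENNReal.toReal_pos hL0 hLt).ne'
  have hln : ‖(L.toReal : ℂ)‖ₑ = L := by
    rw [← ofReal_norm, Complex.norm_real, Real.norm_of_nonneg ENNReal.toReal_nonneg,
      ENNReal.ofReal_toReal hLt]
  have hEm : MeasurableSet (stopRegion κ q f θ) := measurableSet_stopRegion f θ
  set a : region n → ℂ := (L.toReal : ℂ)⁻¹ • (stopRegion κ q f θ).indicator f with ha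
  have ham : Measurable a := (hf.indicator hEm).const_smul _
  obtain ⟨A, hA⟩ := exists_represents (q := q) ham ((hfL.indicator hEm).const_smul _)
  refine ⟨L.toReal, a, A, ham, ⟨ham.aestronglyMeasurable, c, r, hr0, hr, ?_, ?_⟩, hA,
    smul_inv_smul₀ hl0 _, hln.le⟩
  · intro z hz
    have : z ∉ stopRegion κ q f θ := fun h => hz (htent z h)
    simp [ha, this]
  · have he : 0 ≤ 1 - 1 / q := by
      rw [sub_nonneg, div_le_one hq0]; exact hq.out.le
    have he1 : 1 - 1 / q ≤ 1 := by
      have : 0 ≤ 1 / q := by positivity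
      linarith
    rw [ha, eLpNorm_const_smul, enorm_inv hl0, hln, eLpNorm_indicator_eq_massMeasure hq.out f hEm]
    have h1 : massMeasure q f (stopRegion κ q f θ) ^ (1 / q) ≤ b * g ^ (1 / q) := by
      refine (ENNReal.rpow_le_rpow (massMeasure_stopRegion_le f θ) (by positivity)).trans_eq ?_
      rw [ENNReal.mul_rpow_of_nonneg _ _ (by positivity), one_div, ENNReal.rpow_rpow_inv hq0.ne']
    -- `C ≥ 1` and `1 - 1 / q ≤ 1` allow `C^(1 - 1/q)` to be replaced by `C`.
    have h2 : gaussian n (Metric.ball c r) ^ (1 - 1 / q) ≤ C * g ^ (1 - 1 / q) := by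
      refine (ENNReal.rpow_le_rpow hball he).trans ?_
      rw [ENNReal.mul_rpow_of_nonneg _ _ he]
      gcongr
      calc C ^ (1 - 1 / q) ≤ C ^ (1 : ℝ) := ENNReal.rpow_le_rpow_of_exponent_le hC1 he1
        _ = C := ENNReal.rpow_one C
    have h3 : L = (C * g ^ (1 - 1 / q)) * (b * g ^ (1 / q)) := by
      have : g = g ^ (1 - 1 / q) * g ^ (1 / q) := by
        rw [← ENNReal.rpow_add _ _ hg0 hgt, sub_add_cancel, ENNReal.rpow_one]
      rw [hL]
      conv_lhs => rw [this]
      ring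
    have h4 : b * g ^ (1 / q) ≠ 0 := mul_ne_zero hb0 (by simp [hg0, hgt])
    have h5 : b * g ^ (1 / q) ≠ ∞ :=
      ENNReal.mul_ne_top hbt (ENNReal.rpow_ne_top_of_nonneg (by positivity) hgt)
    calc L⁻¹ * massMeasure q f (stopRegion κ q f θ) ^ (1 / q) ≤ L⁻¹ * (b * g ^ (1 / q)) := by gcongr
      _ = (C * g ^ (1 - 1 / q))⁻¹ := by
        rw [h3, ENNReal.mul_inv (Or.inr h5) (Or.inr h4), mul_assoc, ENNReal.inv_mul_cancel h4 h5,
          mul_one]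
      _ ≤ _ := by
        rw [ENNReal.rpow_neg]
        exact ENNReal.inv_le_inv.2 h2

theorem tendsto_massMeasure_compl_biUnion (hq : 1 < q) {f : region n → ℂ}
    (hf : massMeasure q f univ ≠ ∞) :
    Tendsto (fun s : Finset (ℤ × ℕ × (Fin n → ℤ)) =>
      massMeasure q f (⋃ θ ∈ s, stopRegion κ q f θ)ᶜ) atTop (𝓝 0) := by
  have : IsFiniteMeasure (massMeasure q f) := ⟨hf.lt_top⟩
  have hm (θ) := measurableSet_stopRegion (κ := κ) (q := q) f θ
  have hd := pairwise_disjoint_stopRegion (κ := κ) hq f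
  have h1 (s : Finset (ℤ × ℕ × (Fin n → ℤ))) : massMeasure q f (⋃ θ ∈ s, stopRegion κ q f θ)ᶜ =
      massMeasure q f univ - ∑ θ ∈ s, massMeasure q f (stopRegion κ q f θ) := by
    rw [measure_compl (s.measurableSet_biUnion fun θ _ => hm θ) (measure_ne_top _ _),
      measure_biUnion_finset (fun _ _ _ _ h => hd h) fun θ _ => hm θ]
  have h2 : massMeasure q f univ = ∑' θ, massMeasure q f (stopRegion κ q f θ) := by
    rw [← measure_iUnion hd hm]
    refine le_antisymm ?_ (measure_mono (subset_univ _))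
    rw [← union_compl_self (⋃ θ, stopRegion κ q f θ)]
    refine (measure_union_le _ _).trans ?_
    rw [massMeasure_compl_iUnion_stopRegion hq hf, add_zero]
  simp_rw [h1]
  have h3 : Tendsto (fun s : Finset (ℤ × ℕ × (Fin n → ℤ)) =>
      ∑ θ ∈ s, massMeasure q f (stopRegion κ q f θ)) atTop (𝓝 (massMeasure q f univ)) := by
    rw [h2]
    exact ENNReal.summable.hasSum
  simpa using ENNReal.Tendsto.sub (tendsto_const_nhds (x := massMeasure q f univ)) h3 (Or.inl hf)

theorem sum_indicator_stopRegion (hq : 1 < q) (f : region n → ℂ)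
    (s : Finset (ℤ × ℕ × (Fin n → ℤ))) :
    ∑ θ ∈ s, (stopRegion κ q f θ).indicator f = (⋃ θ ∈ s, stopRegion κ q f θ).indicator f := by
  funext z
  rw [Finset.indicator_biUnion_apply s (stopRegion κ q f) fun θ _ θ' _ h =>
    pairwise_disjoint_stopRegion hq f h, Finset.sum_apply]

/-- The atomic decomposition of a continuous function with compact support. -/
theorem exists_decomposition_core (n : ℕ) (q : ℝ) [hq : Fact (1 < q)] (hα : 1 < α) :
    ∃ C : ℝ≥0∞, C ≠ ∞ ∧ ∀ g : TentCore n q,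
      ∃ (l : ℤ × ℕ × (Fin n → ℤ) → ℂ) (a : ℤ × ℕ × (Fin n → ℤ) → region n → ℂ)
        (A : ℤ × ℕ × (Fin n → ℤ) → TentSpace n q),
        (∀ θ, IsAtom q α (a θ)) ∧ (∀ θ, Represents (a θ) (A θ)) ∧ (∀ θ, ‖A θ‖ ≤ 1) ∧
        HasSum (fun θ => l θ • A θ) (g : TentSpace n q) ∧
        ∑' θ, ‖l θ‖ₑ ≤ C * ‖(g : TentSpace n q)‖ₑ := by
  have hq0 : 0 < q := by linarith [hq.out]
  -- These are the conditions of `mem_tent_of_dyadicIndex_eq`; `κ` is then taken large in terms of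
  -- `n` and `δ`, so the constant depends only on `n`, `q`, `α`.
  obtain ⟨δ, hδ0, hδ, hδα⟩ : ∃ δ : ℝ, 0 < δ ∧ δ ≤ 1 / 2 ∧ 3 * δ ≤ α - 1 :=
    ⟨min (1 / 2) ((α - 1) / 3), lt_min (by norm_num) (by linarith), min_le_left _ _, by
      linarith [min_le_right (1 / 2) ((α - 1) / 3)]⟩
  obtain ⟨κ, hκ⟩ : ∃ κ : ℕ, √n * (1 / 2) ^ κ ≤ δ := by
    have h : Tendsto (fun κ : ℕ => √n * (1 / 2 : ℝ) ^ κ) atTop (𝓝 (√n * 0)) :=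
      (tendsto_pow_atTop_nhds_zero_of_lt_one (by norm_num) (by norm_num)).const_mul _
    rw [mul_zero] at h
    exact (h.eventually (ge_mem_nhds hδ0)).exists
  have hCt : compConst n κ ≠ ∞ := ENNReal.ofReal_ne_top
  refine ⟨compConst n κ * (4 * compConst n κ ^ (1 / q)), ENNReal.mul_ne_top hCt
    (ENNReal.mul_ne_top (by simp) (ENNReal.rpow_ne_top_of_nonneg (by positivity) hCt)), fun g => ?_⟩
  have hfm : Measurable g.toFun := g.continuous_toFun.measurable
  have hfL := g.memLp_toFun
  have hfin : massMeasure q g.toFun univ ≠ ∞ := by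
    rw [massMeasure_univ hq.out]
    exact ENNReal.rpow_ne_top_of_nonneg hq0.le hfL.eLpNorm_ne_top
  choose l a A ham ha hA hla hl using fun θ => exists_atom (κ := κ) hκ hδ hδα hfm hfL θ
  refine ⟨l, a, A, ha, hA, fun θ => ?_, ?_, ?_⟩
  · have h1 := ((hA θ).enorm_le (ham θ)).trans (tentENorm_le_one_of_isAtom (ham θ) (ha θ))
    rw [← ofReal_norm, ENNReal.ofReal_le_one] at h1
    exact h1
  · rw [HasSum, tendsto_iff_edist_tendsto_0]
    -- The error of a finite partial sum is, up to sign, `g` restricted to the complement of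
    -- finitely many regions. Its `L^q` norm controls its tent norm.
    have hle (s : Finset (ℤ × ℕ × (Fin n → ℤ))) :
        edist (∑ θ ∈ s, l θ • A θ) (g : TentSpace n q) ≤ gaussian n univ ^ (1 - 1 / q) *
          massMeasure q g.toFun (⋃ θ ∈ s, stopRegion κ q g.toFun θ)ᶜ ^ (1 / q) := by
      have hsm : Measurable (∑ θ ∈ s, l θ • a θ) := by
        convert Finset.measurable_sum s fun θ _ => (ham θ).const_smul (l θ) using 1
        ext z
        simp
      have hrep := (Represents.sum s (fun θ => (ham θ).const_smul (l θ))
        fun θ => (hA θ).smul (ham θ) (l θ)).add hsm (hfm.const_smul (-1 : ℂ))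
        ((represents_coe g).smul hfm (-1))
      have h1 := (hrep.enorm_le (hsm.add (hfm.const_smul _))).trans
        (tentENorm_le_univ hq.out (hsm.add (hfm.const_smul _)))
      rw [edist_eq_enorm_sub, sub_eq_add_neg, ← neg_one_smul ℂ (g : TentSpace n q)]
      refine h1.trans (mul_le_mul_right ?_ _)
      have hEm : MeasurableSet (⋃ θ ∈ s, stopRegion κ q g.toFun θ) :=
        s.measurableSet_biUnion fun θ _ => measurableSet_stopRegion _ θ
      rw [← eLpNorm_indicator_eq_massMeasure hq.out _ hEm.compl, ← eLpNorm_neg]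
      refine le_of_eq (congrArg (fun u => eLpNorm u _ _) ?_)
      rw [Finset.sum_congr rfl fun θ _ => hla θ, sum_indicator_stopRegion hq.out,
        indicator_compl, neg_one_smul]
      abel
    refine tendsto_of_tendsto_of_tendsto_of_le_of_le tendsto_const_nhds ?_ (fun _ => zero_le) hle
    have h2 : gaussian n univ ^ (1 - 1 / q) ≠ ∞ :=
      ENNReal.rpow_ne_top_of_nonneg (by
        rw [sub_nonneg, div_le_one hq0]; exact hq.out.le) (measure_ne_top _ _)
    have h3 := ((tendsto_massMeasure_compl_biUnion (κ := κ) hq.out hfin).ennrpow_const (1 / q))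
    rw [ENNReal.zero_rpow_of_pos (by positivity)] at h3
    simpa using ENNReal.Tendsto.const_mul h3 (Or.inr h2)
  · refine (ENNReal.tsum_le_tsum hl).trans ?_
    rw [ENNReal.tsum_mul_left, TentCore.enorm_def, mul_assoc, mul_assoc]
    gcongr
    exact tsum_stopCells_le hq.out hκ (by linarith) hfm

end GaussianTent

namespace GaussianTent

/-! ### Passage to the completion. -/

/-- Every element of the tent space is an absolutely convergent series of elements of `C_c(D)`. -/
theorem exists_hasSum_core {n : ℕ} {q : ℝ} [Fact (1 < q)] {f : TentSpace n q} (hf : f ≠ 0) :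
    ∃ g : ℕ → TentCore n q, HasSum (fun m => (g m : TentSpace n q)) f ∧
      ∑' m, ‖(g m : TentSpace n q)‖ₑ ≤ ENNReal.ofReal (2 * ‖f‖) := by
  have hf0 : 0 < ‖f‖ := norm_pos_iff.2 hf
  set j : TentCore n q →+ TentSpace n q := UniformSpace.Completion.toCompl
  have hmem : f ∈ closure (j.range : Set (TentSpace n q)) := by
    have h : DenseRange ((↑) : TentCore n q → TentSpace n q) := UniformSpace.Completion.denseRange_coe
    exact h f
  obtain ⟨g, hg, hg0, hgs⟩ := controlled_sum_of_mem_closure_range hmem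
    (f := fun m => ‖f‖ / 2 / 2 ^ m) fun m => by positivity
  -- `g 0` is within `‖f‖ / 2` of `f`, which costs the extra `‖f‖`; the geometric tolerances add up
  -- to another `‖f‖`.
  have hb : HasSum (fun m : ℕ => (if m = 0 then ‖f‖ else 0) + ‖f‖ / 2 / 2 ^ m) (2 * ‖f‖) := by
    rw [two_mul]
    exact (hasSum_ite_eq 0 ‖f‖).add (hasSum_geometric_two' ‖f‖)
  have hle (m : ℕ) : ‖(g m : TentSpace n q)‖ ≤ (if m = 0 then ‖f‖ else 0) + ‖f‖ / 2 / 2 ^ m := by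
    rcases Nat.eq_zero_or_pos m with rfl | hm
    · have h1 : ‖-(g 0 : TentSpace n q) + f‖ < ‖f‖ / 2 / 2 ^ 0 := hg0
      have h2 : (g 0 : TentSpace n q) = f - (-(g 0 : TentSpace n q) + f) := by abel
      rw [if_pos rfl, h2]
      exact (norm_sub_le _ _).trans (by gcongr)
    · rw [if_neg hm.ne', zero_add]
      exact (hgs m hm).le
  have hs : Summable fun m => ‖(g m : TentSpace n q)‖ :=
    Summable.of_nonneg_of_le (fun _ => norm_nonneg _) hle hb.summable
  refine ⟨g, ?_, ?_⟩
  · have h1 := hs.of_norm.hasSum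
    rwa [tendsto_nhds_unique ((tendsto_add_atTop_iff_nat 1).2 h1.tendsto_sum_nat) hg] at h1
  · simp_rw [← ofReal_norm]
    rw [← ENNReal.ofReal_tsum_of_nonneg (fun _ => norm_nonneg _) hs]
    refine ENNReal.ofReal_le_ofReal ?_
    rw [← hb.tsum_eq]
    exact hs.tsum_le_tsum hle hb.summable

end GaussianTent

open GaussianTent
theorem mainTheorem3 (n : ℕ) (hn : 1 ≤ n) (q : ℝ) [hq : Fact (1 < q)] (α : ℝ) (hα : 1 < α) :
    ∃ C : ℝ, ∀ f : TentSpace n q,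
      ∃ (l : ℕ → ℂ) (a : ℕ → region n → ℂ) (A : ℕ → TentSpace n q),
        (∀ k, IsAtom q α (a k)) ∧
        (∀ k, Represents (a k) (A k)) ∧
        Summable (fun k => ‖l k‖) ∧
        HasSum (fun k => l k • A k) f ∧
        ∑' k, ‖l k‖ ≤ C * ‖f‖ := by
  obtain ⟨C, hC, hdec⟩ := exists_decomposition_core n q hα
  refine ⟨C.toReal * 2, fun f => ?_⟩
  rcases eq_or_ne f 0 with rfl | hf
  · exact ⟨0, 0, 0, fun _ => isAtom_zero (by linarith), fun _ => represents_zero,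
      by simp, by simp, by simp⟩
  obtain ⟨g, hg, hgs⟩ := exists_hasSum_core hf
  choose l a A ha hA hA1 hsum hl using fun m => hdec (g m)
  obtain ⟨e⟩ : Nonempty (ℕ ≃ ℕ × (ℤ × ℕ × (Fin n → ℤ))) := nonempty_equiv_of_countable
  have hnorm : ∑' x : ℕ × (ℤ × ℕ × (Fin n → ℤ)), ‖l x.1 x.2‖ₑ ≤
      ENNReal.ofReal (C.toReal * 2 * ‖f‖) := by
    rw [ENNReal.tsum_prod']
    refine (ENNReal.tsum_le_tsum hl).trans ?_
    rw [ENNReal.tsum_mul_left, mul_assoc, ENNReal.ofReal_mul ENNReal.toReal_nonneg,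
      ENNReal.ofReal_toReal hC]
    gcongr
  have hs : Summable fun x : ℕ × (ℤ × ℕ × (Fin n → ℤ)) => ‖l x.1 x.2‖ := by
    have h := ENNReal.summable_toReal (hnorm.trans_lt ENNReal.ofReal_lt_top).ne
    simpa only [toReal_enorm] using h
  -- The atoms have norm at most one, so the double series converges absolutely and may be summed in
  -- any order.
  have hsA : Summable fun x : ℕ × (ℤ × ℕ × (Fin n → ℤ)) => l x.1 x.2 • A x.1 x.2 := by
    refine Summable.of_norm_bounded hs fun x => ?_
    rw [norm_smul]
    exact mul_le_of_le_one_right (norm_nonneg _) (hA1 _ _)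
  have hfA : HasSum (fun x : ℕ × (ℤ × ℕ × (Fin n → ℤ)) => l x.1 x.2 • A x.1 x.2) f := by
    have h := hsA.hasSum
    rwa [(h.prod_fiberwise fun m => hsum m).unique hg] at h
  refine ⟨fun k => l (e k).1 (e k).2, fun k => a (e k).1 (e k).2, fun k => A (e k).1 (e k).2,
    fun k => ha _ _, fun k => hA _ _, e.summable_iff.2 hs, e.hasSum_iff.2 hfA, ?_⟩
  rw [e.tsum_eq fun x : ℕ × (ℤ × ℕ × (Fin n → ℤ)) => ‖l x.1 x.2‖]
  rw [← ENNReal.ofReal_le_ofReal_iff (by positivity),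
    ENNReal.ofReal_tsum_of_nonneg (fun _ => norm_nonneg _) hs]
  simpa only [ofReal_norm] using hnorm
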